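/- **Language.** Let $\mathcal A$ (agent identifiers), $\mathcal B$ (broadcast names), $\mathcal C$ (handshake names) be sets. Let $\mathcal H=\mathcal C\uplus\bar{\mathcal C}$ be the handshake actions, with $\bar{\bar c}=c$, and let $Act=\{b!\mid b\in\mathcal B\}\uplus\{b?\mid b\in\mathcal B\}\uplus\mathcal H\uplus\{\tau\}$; write $\mathcal B!$ and $\mathcal B?$ for the first two parts. The *non-blocking* actions are those in $\mathcal B!\cup\{\tau\}$. A relabelling $f$ consists of maps $\mathcal B\to\mathcal B$ and $\mathcal C\to\mathcal C$, extended to $Act$ by $f(\bar c)=\overline{f(c)}$, $f(b!)=f(b)!$, $f(b?)=f(b)?$, $f(\tau)=\tau$. ABC processes are given by $$P::=0\mid\alpha.P\mid P+P\mid P|P\mid P\backslash c\mid P[f]\mid A\qquad(\alpha\in Act,\ c\in\mathcal H,\ A\in\mathcal A),$$ and each $A\in\mathcal A$ has a defining equation $A\stackrel{def}{=}P_A$ in which $P_A$ is guarded: every agent identifier in it occurs inside the scope of a prefix $\alpha.\_$. **Transitions and derivations.** Transitions $P\xrightarrow{\alpha}Q$ are derived by the following rules; the name of the resulting derivation is given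 in brackets ($\chi,\zeta$ name the derivations of the premises). Here $\eta\in\mathcal H\cup\{\tau\}$, $c\in\mathcal H$, $\alpha\in Act$, $\sharp,\sharp_1,\sharp_2\in\{!,?\}$, with $!\circ{?}={?}\circ{!}={!}$, ${?}\circ{?}={?}$, and $!\circ{!}$ undefined. - $\alpha.P\xrightarrow{\alpha}P$ $[\overset{\alpha}{\to}P]$. - If $P\xrightarrow{\alpha}P'$ then $P+Q\xrightarrow{\alpha}P'$ $[\chi+Q]$ and $Q+P\xrightarrow{\alpha}P'$ $[Q+\chi]$. - If $P\xrightarrow{\eta}P'$ then $P|Q\xrightarrow{\eta}P'|Q$ $[\chi|Q]$ and $Q|P\xrightarrow{\eta}Q|P'$ $[Q|\chi]$. - If $P\xrightarrow{c}P'$ and $Q\xrightarrow{\bar c}Q'$ then $P|Q\xrightarrow{\tau}P'|Q'$ $[\chi|\zeta]$. - If $P\xrightarrow{b\sharp}P'$ and $Q$ has no $b?$-transition then $P|Q\xrightarrow{b\sharp}P'|Q$ $[\chi|Q]$ and $Q|P\xrightarrow{b\sharp}Q|P'$ $[Q|\chi]$. - If $P\xrightarrow{b\sharp_1}P'$, $Q\xrightarrow{b\sharp_2}Q'$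 and $\sharp_1\circ\sharp_2=\sharp$ is defined, then $P|Q\xrightarrow{b\sharp}P'|Q'$ $[\chi|\zeta]$. - If $P\xrightarrow{\alpha}P'$ then $P[f]\xrightarrow{f(\alpha)}P'[f]$ $[\chi[f]]$, and, when $c\neq\alpha\neq\bar c$, $P\backslash c\xrightarrow{\alpha}P'\backslash c$ $[\chi\backslash c]$. - If $P_A\xrightarrow{\alpha}P'$ then $A\xrightarrow{\alpha}P'$ $[A{:}\chi]$. For a derivation $\chi$ of $P\xrightarrow{\alpha}Q$ put $src(\chi)=P$, $\ell(\chi)=\alpha$, $target(\chi)=Q$. **The structures $\mathcal S$ and $\mathcal U$.** The states of $\mathcal S$ are the processes and the transitions $t=(P\xrightarrow{\alpha}Q)$, and $\mathcal S$ has the steps $P\to t$ and $t\to Q$. The states of $\mathcal U$ are the processes and the derivations, with steps $src(\chi)\to\chi$ and $\chi\to target(\chi)$. A path is a nonempty finite or infinite sequence of states, consecutive ones being related by a step, which is infinite or ends in a process; it is a path of its first state. The projection $\widehat\pi$ of a path $\pi$ in $\mathcal U$ to $\mathcal S$ keeps processes and replaces each derivation by the transition it derives. **Justness.** A transition of $P|Q$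 decomposes into the premise transition(s) from which it can be derived by one of the rules for $|$, together with the state of the idle component, if any. A decomposition of a path of $P|Q$ in $\mathcal S$ decomposes each of its transitions and concatenates the left, resp. right, parts into a path of $P$ and a path of $Q$ (either of which may be finite even if the given path is infinite). Decompositions of paths of $P\backslash c$ and $P[f]$ into paths of $P$ are defined likewise. *$Y$-justness*, for $Y\subseteq\mathcal H$, is the largest family of predicates on the paths in $\mathcal S$ such that 1. a finite $Y$-just path ends in a process all of whose transitions have labels in $Y\cup\mathcal B?$; 2. a $Y$-just path of $P|Q$ can be decomposed into an $X$-just path of $P$ and a $Z$-just path of $Q$ with $X\cup Z\subseteq Y$ and $X\cap\{\bar c\mid c\in Z\}=\emptyset$; 3. a $Y$-just path of $P\backslash c$ can be decomposed into a $(Y\cup\{c,\bar c\})$-just path of $P$; 4. a $Y$-just path of $P[f]$ can be decomposed into an $f^{-1}(Y)$-just path of $P$; 5. every suffix of a $Y$-just path is $Y$-just. A path is *just* if it is $Y$-just for some $Y\subseteq\mathcal H$. **Concurrency.** Let $\leadsto$ be the smallest relation on derivations such that, whenever the composed derivations exist, - $\chi|Q\leadsto P|\zeta$ and $P|\zeta\leadsto\chi|Q$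 if $src(\chi)=P$, $src(\zeta)=Q$; - $\chi|\varsigma\leadsto P|\zeta$ and $\varsigma|\chi\leadsto\zeta|P$ if $src(\chi)=P$, $src(\varsigma)=src(\zeta)$, $\ell(\varsigma)\in\mathcal B?$; - if $\chi\leadsto\zeta$ then $\chi{+}P\leadsto\zeta{+}P$, $P{+}\chi\leadsto P{+}\zeta$, $\chi|P\leadsto\zeta|P$, $P|\chi\leadsto P|\zeta$, $\chi\backslash c\leadsto\zeta\backslash c$, $\chi[f]\leadsto\zeta[f]$, $A{:}\chi\leadsto A{:}\zeta$; - if $\chi\leadsto\zeta$ and $P=src(\xi)$ then $\chi|P\leadsto\zeta|\xi$, $\chi|\xi\leadsto\zeta|P$, $P|\chi\leadsto\xi|\zeta$, $\xi|\chi\leadsto P|\zeta$; - if $\chi\leadsto\zeta$, $src(\varsigma)=src(\xi)$ and $\ell(\varsigma)\in\mathcal B?$ then $\chi|\varsigma\leadsto\zeta|\xi$ and $\varsigma|\chi\leadsto\xi|\zeta$; - if $\chi\leadsto\zeta$ and $\varsigma\leadsto\xi$ then $\chi|\varsigma\leadsto\zeta|\xi$. **Abstract transitions.** Let $\equiv$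 be the smallest equivalence relation on the derivations $\chi$ with $\ell(\chi)\notin\mathcal B?$ such that, whenever the composed derivations exist (and lie in this domain), $\chi|P\equiv\chi|Q$; $P|\chi\equiv Q|\chi$; $\chi|\varsigma\equiv\chi|P$ and $\varsigma|\chi\equiv P|\chi$ if $\ell(\chi)\in\mathcal B!$; $\chi{+}P\equiv\chi\equiv P{+}\chi$; $A{:}\chi\equiv\chi$; if $\chi\equiv\zeta$ then $\chi\backslash c\equiv\zeta\backslash c$, $\chi[f]\equiv\zeta[f]$, $\chi|P\equiv\zeta|P$, $P|\chi\equiv P|\zeta$; and if $\chi\equiv\zeta$ and $\varsigma\equiv\xi$ then $\chi|\varsigma\equiv\zeta|\xi$. An *abstract transition* $\nu$ is an $\equiv$-class; its elements are its representatives, and $\ell(\nu)$ is their common label. On states of $\mathcal U$, the proposition $\nu$ holds exactly in the derivations $\zeta\in\nu$; the proposition $en(\nu)$ holds in a process $P$ iff $P=src(\chi)$ for some $\chi\in\nu$, and in a derivation $\zeta$ iff $\chi\leadsto\zeta$ for some $\chi\in\nu$. LTL formulas are interpreted on finite and infinite paths: $\mathbf G\phi$ (resp. $\mathbf F\phi$)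 holds for a path iff $\phi$ holds for all (resp. some) of its nonempty suffixes, and an atomic proposition holds for a path iff it holds in its first state. **Theorem.** A path $\rho$ in $\mathcal S$ of an ABC process is just if and only if $\rho=\widehat\pi$ for some path $\pi$ in $\mathcal U$ that satisfies $\mathbf F\mathbf G\,en(\nu)\Rightarrow\mathbf G\mathbf F\,\nu$ for every abstract transition $\nu$ whose label $\ell(\nu)$ is a non-blocking action. -/

import Mathlib

namespace ABC

universe u v w

/-! ### Syntax -/

/-- Handshake actions: names `c` and co-names `c̄` over a set `C` of handshake names. -/
inductive HS (C : Type w) : Type w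
  | name (c : C) : HS C
  | coname (c : C) : HS C

/-- The involution `c ↦ c̄`. -/
def HS.bar {C : Type w} : HS C → HS C
  | .name c => .coname c
  | .coname c => .name c

/-- The marks `!` (broadcast) and `?` (receive). -/
inductive Sharp : Type
  | bang : Sharp
  | query : Sharp

/-- The partial composition `♯₁ ∘ ♯₂` of marks; `none` stands for "undefined". -/
def Sharp.comp : Sharp → Sharp → Option Sharp
  | .bang, .bang => none
  | .bang, .query => some .bang
  | .query, .bang => some .bang
  | .query, .query => some .query

/-- Actions: `bc .bang b` is the broadcast `b!`, `bc .query b` is the receive action `b?`. -/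
inductive Act (B : Type v) (C : Type w) : Type (max v w)
  | bc (s : Sharp) (b : B) : Act B C
  | hs (c : HS C) : Act B C
  | tau : Act B C

/-- The receive actions `b?`. -/
def Act.IsReceive {B : Type v} {C : Type w} (α : Act B C) : Prop := ∃ b, α = .bc .query b

/-- The broadcast actions `b!`. -/
def Act.IsBroadcast {B : Type v} {C : Type w} (α : Act B C) : Prop := ∃ b, α = .bc .bang b

/-- The actions over which `η` ranges in the rules: handshake actions and `τ`. -/
def Act.IsEta {B : Type v} {C : Type w} (α : Act B C) : Prop := (∃ c, α = .hs c) ∨ α = .tau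

/-- The non-blocking actions: broadcasts and `τ`. -/
def Act.NonBlocking {B : Type v} {C : Type w} (α : Act B C) : Prop := α.IsBroadcast ∨ α = .tau

/-- A relabelling maps broadcast names to broadcast names and handshake names to
handshake names. -/
structure Relabelling (B : Type v) (C : Type w) : Type (max v w) where
  onB : B → B
  onC : C → C

/-- Extension of a relabelling to handshake actions, with `f(c̄) = f(c)̄`. -/
def Relabelling.onHS {B : Type v} {C : Type w} (f : Relabelling B C) : HS C → HS C
  | .name c => .name (f.onC c)
  | .coname c => .coname (f.onC c)

/-- Extension of a relabelling to actions. -/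
def Relabelling.onAct {B : Type v} {C : Type w} (f : Relabelling B C) : Act B C → Act B C
  | .bc s b => .bc s (f.onB b)
  | .hs c => .hs (f.onHS c)
  | .tau => .tau

/-- ABC expressions (processes). -/
inductive Proc (A : Type u) (B : Type v) (C : Type w) : Type (max u v w)
  | nil : Proc A B C
  | pre (α : Act B C) (P : Proc A B C) : Proc A B C
  | sum (P Q : Proc A B C) : Proc A B C
  | par (P Q : Proc A B C) : Proc A B C
  | res (P : Proc A B C) (c : HS C) : Proc A B C
  | rel (P : Proc A B C) (f : Relabelling B C) : Proc A B C
  | ident (a : A) : Proc A B C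

/-- Every agent identifier occurs within the scope of a prefixing operator. -/
def Proc.Guarded {A : Type u} {B : Type v} {C : Type w} : Proc A B C → Prop
  | .nil => True
  | .pre _ _ => True
  | .sum P Q => P.Guarded ∧ Q.Guarded
  | .par P Q => P.Guarded ∧ Q.Guarded
  | .res P _ => P.Guarded
  | .rel P _ => P.Guarded
  | .ident _ => False

section Semantics

variable {A : Type u} {B : Type v} {C : Type w}

/-! ### Operational semantics -/

/-- `Receives D P b`: the process `P` admits a `b?`-transition. The rules have negative premises of
the form "`P` admits no `b?`-transition"; this predicate is used to state these. Lemma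
`receives_iff` below shows that it means what it says in the generated transition system.
Here `D a` is the right-hand side of the defining equation of the agent identifier `a`. -/
inductive Receives (D : A → Proc A B C) : Proc A B C → B → Prop
  | act (b : B) (P : Proc A B C) : Receives D (.pre (.bc .query b) P) b
  | sumL {P Q : Proc A B C} {b : B} : Receives D P b → Receives D (.sum P Q) b
  | sumR {P Q : Proc A B C} {b : B} : Receives D Q b → Receives D (.sum P Q) b
  | parL {P Q : Proc A B C} {b : B} : Receives D P b → Receives D (.par P Q) b
  | parR {P Q : Proc A B C} {b : B} : Receives D Q b → Receives D (.par P Q) b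
  | res {P : Proc A B C} {b : B} (c : HS C) : Receives D P b → Receives D (.res P c) b
  | rel {P : Proc A B C} {b : B} (f : Relabelling B C) :
      Receives D P b → Receives D (.rel P f) (f.onB b)
  | recu {a : A} {b : B} : Receives D (D a) b → Receives D (.ident a) b

/-- Names for derivations: `act α P` is the derivation by the prefix axiom of `α.P —α→ P`,
`sumL χ Q` is `χ+Q`, `sumR P χ` is `P+χ`, `parL χ Q` is `χ|Q`, `parR P χ` is `P|χ`,
`parB χ ζ` is `χ|ζ`, `res χ c` is `χ\c`, `rel χ f` is `χ[f]` and `recu a χ` is `a:χ`. -/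
inductive DTerm (A : Type u) (B : Type v) (C : Type w) : Type (max u v w)
  | act (α : Act B C) (P : Proc A B C) : DTerm A B C
  | sumL (χ : DTerm A B C) (Q : Proc A B C) : DTerm A B C
  | sumR (P : Proc A B C) (χ : DTerm A B C) : DTerm A B C
  | parL (χ : DTerm A B C) (Q : Proc A B C) : DTerm A B C
  | parR (P : Proc A B C) (χ : DTerm A B C) : DTerm A B C
  | parB (χ ζ : DTerm A B C) : DTerm A B C
  | res (χ : DTerm A B C) (c : HS C) : DTerm A B C
  | rel (χ : DTerm A B C) (f : Relabelling B C) : DTerm A B C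
  | recu (a : A) (χ : DTerm A B C) : DTerm A B C

/-- `Derives D χ P α Q`: `χ` is (the name of) a derivation of the transition `P —α→ Q` from the
structural operational rules of ABC. -/
inductive Derives (D : A → Proc A B C) :
    DTerm A B C → Proc A B C → Act B C → Proc A B C → Prop
  | act (α : Act B C) (P : Proc A B C) : Derives D (.act α P) (.pre α P) α P
  | sumL {χ P α P'} (Q : Proc A B C) :
      Derives D χ P α P' → Derives D (.sumL χ Q) (.sum P Q) α P'
  | sumR {χ Q α Q'} (P : Proc A B C) :
      Derives D χ Q α Q' → Derives D (.sumR P χ) (.sum P Q) α Q'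
  | parL {χ P η P'} (Q : Proc A B C) (hη : η.IsEta) :
      Derives D χ P η P' → Derives D (.parL χ Q) (.par P Q) η (.par P' Q)
  | comm {χ P P' ζ Q Q'} (c : HS C) :
      Derives D χ P (.hs c) P' → Derives D ζ Q (.hs c.bar) Q' →
      Derives D (.parB χ ζ) (.par P Q) .tau (.par P' Q')
  | parR {χ Q η Q'} (P : Proc A B C) (hη : η.IsEta) :
      Derives D χ Q η Q' → Derives D (.parR P χ) (.par P Q) η (.par P Q')
  | broL {χ P P' Q} {s : Sharp} {b : B} :
      Derives D χ P (.bc s b) P' → ¬ Receives D Q b →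
      Derives D (.parL χ Q) (.par P Q) (.bc s b) (.par P' Q)
  | broC {χ P P' ζ Q Q'} {s₁ s₂ s : Sharp} {b : B} (h : s₁.comp s₂ = some s) :
      Derives D χ P (.bc s₁ b) P' → Derives D ζ Q (.bc s₂ b) Q' →
      Derives D (.parB χ ζ) (.par P Q) (.bc s b) (.par P' Q')
  | broR {χ P Q Q'} {s : Sharp} {b : B} :
      ¬ Receives D P b → Derives D χ Q (.bc s b) Q' →
      Derives D (.parR P χ) (.par P Q) (.bc s b) (.par P Q')
  | rel {χ P α P'} (f : Relabelling B C) :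
      Derives D χ P α P' → Derives D (.rel χ f) (.rel P f) (f.onAct α) (.rel P' f)
  | res {χ P α P'} (c : HS C) (h₁ : α ≠ .hs c) (h₂ : α ≠ .hs c.bar) :
      Derives D χ P α P' → Derives D (.res χ c) (.res P c) α (.res P' c)
  | recu {χ α P'} (a : A) :
      Derives D χ (D a) α P' → Derives D (.recu a χ) (.ident a) α P'

/-- The transition relation `P —α→ Q` of the labelled transition system of ABC. -/
def Step (D : A → Proc A B C) (P : Proc A B C) (α : Act B C) (Q : Proc A B C) : Prop :=
  ∃ χ, Derives D χ P α Q

theorem Receives.of_derives {D : A → Proc A B C} {χ : DTerm A B C} {P Q : Proc A B C}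
    {α : Act B C} (h : Derives D χ P α Q) : ∀ b, α = .bc .query b → Receives D P b := by
  induction h with
  | act α P => rintro b rfl; exact .act b P
  | sumL Q _ ih => exact fun b hb => .sumL (ih b hb)
  | sumR P _ ih => exact fun b hb => .sumR (ih b hb)
  | parL Q _ _ ih => exact fun b hb => .parL (ih b hb)
  | comm c _ _ _ _ => intro b hb; cases hb
  | parR P _ _ ih => exact fun b hb => .parR (ih b hb)
  | broL _ _ ih => exact fun b hb => .parL (ih b hb)
  | @broC _ _ _ _ _ _ s₁ s₂ s b' h _ _ ih₁ ih₂ =>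
    intro b hb
    cases hb
    cases s₁
    · cases s₂ <;> simp [Sharp.comp] at h
    · exact .parL (ih₁ _ rfl)
  | broR _ _ ih => exact fun b hb => .parR (ih b hb)
  | @rel _ _ α _ f _ ih =>
    intro b hb
    cases α with
    | bc s b' =>
      simp only [Relabelling.onAct, Act.bc.injEq] at hb
      obtain ⟨rfl, rfl⟩ := hb
      exact .rel f (ih b' rfl)
    | hs c => simp [Relabelling.onAct] at hb
    | tau => simp [Relabelling.onAct] at hb
  | res c _ _ _ ih => exact fun b hb => .res c (ih b hb)
  | recu a _ ih => exact fun b hb => .recu (ih b hb)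

theorem Receives.exists_step_par {D : A → Proc A B C} {P Q : Proc A B C} {b : B}
    (hP : Receives D P b → ∃ P', Step D P (.bc .query b) P')
    (hQ : Receives D Q b → ∃ Q', Step D Q (.bc .query b) Q')
    (h : Receives D P b ∨ Receives D Q b) : ∃ R, Step D (.par P Q) (.bc .query b) R := by
  by_cases h₁ : Receives D P b
  · obtain ⟨P', χ, hχ⟩ := hP h₁
    by_cases h₂ : Receives D Q b
    · obtain ⟨Q', ζ, hζ⟩ := hQ h₂
      exact ⟨_, _, .broC rfl hχ hζ⟩
    · exact ⟨_, _, .broL hχ h₂⟩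
  · obtain ⟨Q', ζ, hζ⟩ := hQ (h.resolve_left h₁)
    exact ⟨_, _, .broR h₁ hζ⟩

theorem Receives.exists_step_guarded {D : A → Proc A B C} {P : Proc A B C} (hP : P.Guarded) :
    ∀ b, Receives D P b → ∃ P', Step D P (.bc .query b) P' := by
  induction P with
  | nil => intro b h; cases h
  | pre α P => intro b h; cases h; exact ⟨_, _, .act _ _⟩
  | sum P Q ihP ihQ =>
    intro b h
    cases h with
    | sumL h => obtain ⟨R, χ, hχ⟩ := ihP hP.1 b h; exact ⟨_, _, .sumL Q hχ⟩
    | sumR h => obtain ⟨R, χ, hχ⟩ := ihQ hP.2 b h; exact ⟨_, _, .sumR P hχ⟩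
  | par P Q ihP ihQ =>
    intro b h
    refine exists_step_par (ihP hP.1 b) (ihQ hP.2 b) ?_
    cases h with
    | parL h => exact .inl h
    | parR h => exact .inr h
  | res P c ih =>
    intro b h
    cases h with
    | res _ h =>
      obtain ⟨R, χ, hχ⟩ := ih hP b h
      exact ⟨_, _, .res c (by simp) (by simp) hχ⟩
  | rel P f ih =>
    intro b h
    cases h with
    | rel _ h => obtain ⟨R, χ, hχ⟩ := ih hP _ h; exact ⟨_, _, .rel f hχ⟩
  | ident a => exact absurd hP id

theorem Receives.exists_step {D : A → Proc A B C} (hD : ∀ a, (D a).Guarded) (P : Proc A B C) :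
    ∀ b, Receives D P b → ∃ P', Step D P (.bc .query b) P' := by
  induction P with
  | nil => intro b h; cases h
  | pre α P => intro b h; cases h; exact ⟨_, _, .act _ _⟩
  | sum P Q ihP ihQ =>
    intro b h
    cases h with
    | sumL h => obtain ⟨R, χ, hχ⟩ := ihP b h; exact ⟨_, _, .sumL Q hχ⟩
    | sumR h => obtain ⟨R, χ, hχ⟩ := ihQ b h; exact ⟨_, _, .sumR P hχ⟩
  | par P Q ihP ihQ =>
    intro b h
    refine exists_step_par (ihP b) (ihQ b) ?_
    cases h with
    | parL h => exact .inl h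
    | parR h => exact .inr h
  | res P c ih =>
    intro b h
    cases h with
    | res _ h =>
      obtain ⟨R, χ, hχ⟩ := ih b h
      exact ⟨_, _, .res c (by simp) (by simp) hχ⟩
  | rel P f ih =>
    intro b h
    cases h with
    | rel _ h => obtain ⟨R, χ, hχ⟩ := ih _ h; exact ⟨_, _, .rel f hχ⟩
  | ident a =>
    intro b h
    cases h with
    | recu h =>
      obtain ⟨R, χ, hχ⟩ := exists_step_guarded (hD a) b h
      exact ⟨_, _, .recu a hχ⟩

/-- With guarded defining equations, the negative premises `¬ Receives D P b` of the rules
say exactly that `P` admits no `b?`-transition. -/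
theorem receives_iff {D : A → Proc A B C} (hD : ∀ a, (D a).Guarded) (P : Proc A B C) (b : B) :
    Receives D P b ↔ ∃ Q, Step D P (.bc .query b) Q :=
  ⟨Receives.exists_step hD P b, fun ⟨_, _, h⟩ => Receives.of_derives h b rfl⟩

/-! ### Derivations: source, label and target -/

/-- The source of a derivation. -/
def DTerm.src : DTerm A B C → Proc A B C
  | .act α P => .pre α P
  | .sumL χ Q => .sum χ.src Q
  | .sumR P χ => .sum P χ.src
  | .parL χ Q => .par χ.src Q
  | .parR P χ => .par P χ.src
  | .parB χ ζ => .par χ.src ζ.src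
  | .res χ c => .res χ.src c
  | .rel χ f => .rel χ.src f
  | .recu a _ => .ident a

/-- The target of a derivation. -/
def DTerm.tgt : DTerm A B C → Proc A B C
  | .act _ P => P
  | .sumL χ _ => χ.tgt
  | .sumR _ χ => χ.tgt
  | .parL χ Q => .par χ.tgt Q
  | .parR P χ => .par P χ.tgt
  | .parB χ ζ => .par χ.tgt ζ.tgt
  | .res χ c => .res χ.tgt c
  | .rel χ f => .rel χ.tgt f
  | .recu _ χ => χ.tgt

/-- The label of a synchronisation (with junk values for labels that cannot synchronise). -/
def Act.sync : Act B C → Act B C → Act B C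
  | .bc s₁ b, .bc s₂ _ => .bc ((s₁.comp s₂).getD .bang) b
  | _, _ => .tau

/-- The label of a derivation. -/
def DTerm.lab : DTerm A B C → Act B C
  | .act α _ => α
  | .sumL χ _ => χ.lab
  | .sumR _ χ => χ.lab
  | .parL χ _ => χ.lab
  | .parR _ χ => χ.lab
  | .parB χ ζ => χ.lab.sync ζ.lab
  | .res χ _ => χ.lab
  | .rel χ f => f.onAct χ.lab
  | .recu _ χ => χ.lab

/-- A derivation derives exactly one transition, given by `src`, `lab` and `tgt`. -/
theorem Derives.eq {D : A → Proc A B C} {χ : DTerm A B C} {P Q : Proc A B C} {α : Act B C}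
    (h : Derives D χ P α Q) : χ.src = P ∧ χ.lab = α ∧ χ.tgt = Q := by
  induction h <;> simp_all [DTerm.src, DTerm.lab, DTerm.tgt, Act.sync]

/-- `χ` is a derivation. -/
def IsDer (D : A → Proc A B C) (χ : DTerm A B C) : Prop := ∃ P α Q, Derives D χ P α Q

theorem IsDer.derives {D : A → Proc A B C} {χ : DTerm A B C} (h : IsDer D χ) :
    Derives D χ χ.src χ.lab χ.tgt := by
  obtain ⟨P, α, Q, h⟩ := h
  obtain ⟨rfl, rfl, rfl⟩ := h.eq
  exact h

/-! ### Concurrency of derivations -/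

/-- The (asymmetric) concurrency relation on derivations: `Conc D χ ζ` says that the possible
occurrence of `χ` is unaffected by the occurrence of `ζ`. The hypotheses `IsDer` of each clause say
that the composed derivations exist. -/
inductive Conc (D : A → Proc A B C) : DTerm A B C → DTerm A B C → Prop
  | left_right {χ ζ : DTerm A B C} {P Q : Proc A B C} :
      IsDer D (.parL χ Q) → IsDer D (.parR P ζ) → χ.src = P → ζ.src = Q →
      Conc D (.parL χ Q) (.parR P ζ)
  | right_left {χ ζ : DTerm A B C} {P Q : Proc A B C} :
      IsDer D (.parR P ζ) → IsDer D (.parL χ Q) → χ.src = P → ζ.src = Q →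
      Conc D (.parR P ζ) (.parL χ Q)
  | both_right {χ ς ζ : DTerm A B C} {P : Proc A B C} :
      IsDer D (.parB χ ς) → IsDer D (.parR P ζ) → χ.src = P → ς.src = ζ.src →
      ς.lab.IsReceive → Conc D (.parB χ ς) (.parR P ζ)
  | both_left {χ ς ζ : DTerm A B C} {P : Proc A B C} :
      IsDer D (.parB ς χ) → IsDer D (.parL ζ P) → χ.src = P → ς.src = ζ.src →
      ς.lab.IsReceive → Conc D (.parB ς χ) (.parL ζ P)
  | sumL {χ ζ : DTerm A B C} {P : Proc A B C} : Conc D χ ζ →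
      IsDer D (.sumL χ P) → IsDer D (.sumL ζ P) → Conc D (.sumL χ P) (.sumL ζ P)
  | sumR {χ ζ : DTerm A B C} {P : Proc A B C} : Conc D χ ζ →
      IsDer D (.sumR P χ) → IsDer D (.sumR P ζ) → Conc D (.sumR P χ) (.sumR P ζ)
  | parL {χ ζ : DTerm A B C} {P : Proc A B C} : Conc D χ ζ →
      IsDer D (.parL χ P) → IsDer D (.parL ζ P) → Conc D (.parL χ P) (.parL ζ P)
  | parR {χ ζ : DTerm A B C} {P : Proc A B C} : Conc D χ ζ →
      IsDer D (.parR P χ) → IsDer D (.parR P ζ) → Conc D (.parR P χ) (.parR P ζ)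
  | parL_parB {χ ζ ξ : DTerm A B C} {P : Proc A B C} : Conc D χ ζ → P = ξ.src →
      IsDer D (.parL χ P) → IsDer D (.parB ζ ξ) → Conc D (.parL χ P) (.parB ζ ξ)
  | parB_parL {χ ζ ξ : DTerm A B C} {P : Proc A B C} : Conc D χ ζ → P = ξ.src →
      IsDer D (.parB χ ξ) → IsDer D (.parL ζ P) → Conc D (.parB χ ξ) (.parL ζ P)
  | parR_parB {χ ζ ξ : DTerm A B C} {P : Proc A B C} : Conc D χ ζ → P = ξ.src →
      IsDer D (.parR P χ) → IsDer D (.parB ξ ζ) → Conc D (.parR P χ) (.parB ξ ζ)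
  | parB_parR {χ ζ ξ : DTerm A B C} {P : Proc A B C} : Conc D χ ζ → P = ξ.src →
      IsDer D (.parB ξ χ) → IsDer D (.parR P ζ) → Conc D (.parB ξ χ) (.parR P ζ)
  | parB_receiveR {χ ζ ς ξ : DTerm A B C} : Conc D χ ζ → ς.src = ξ.src → ς.lab.IsReceive →
      IsDer D (.parB χ ς) → IsDer D (.parB ζ ξ) → Conc D (.parB χ ς) (.parB ζ ξ)
  | parB_receiveL {χ ζ ς ξ : DTerm A B C} : Conc D χ ζ → ς.src = ξ.src → ς.lab.IsReceive →
      IsDer D (.parB ς χ) → IsDer D (.parB ξ ζ) → Conc D (.parB ς χ) (.parB ξ ζ)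
  | parB {χ ζ ς ξ : DTerm A B C} : Conc D χ ζ → Conc D ς ξ →
      IsDer D (.parB χ ς) → IsDer D (.parB ζ ξ) → Conc D (.parB χ ς) (.parB ζ ξ)
  | res {χ ζ : DTerm A B C} {c : HS C} : Conc D χ ζ →
      IsDer D (.res χ c) → IsDer D (.res ζ c) → Conc D (.res χ c) (.res ζ c)
  | rel {χ ζ : DTerm A B C} {f : Relabelling B C} : Conc D χ ζ →
      IsDer D (.rel χ f) → IsDer D (.rel ζ f) → Conc D (.rel χ f) (.rel ζ f)
  | recu {χ ζ : DTerm A B C} {a : A} : Conc D χ ζ →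
      IsDer D (.recu a χ) → IsDer D (.recu a ζ) → Conc D (.recu a χ) (.recu a ζ)

/-! ### Abstract transitions -/

/-- `χ` is a derivation whose label is not a receive action. -/
def Dom (D : A → Proc A B C) (χ : DTerm A B C) : Prop := IsDer D χ ∧ ¬ χ.lab.IsReceive

/-- The smallest equivalence relation `≡` on the derivations whose label is not a receive action
that satisfies the listed clauses. The hypotheses `Dom` say that the composed derivations exist and
lie in the domain of the relation. -/
inductive Equiv (D : A → Proc A B C) : DTerm A B C → DTerm A B C → Prop
  | refl {χ : DTerm A B C} : Dom D χ → Equiv D χ χ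
  | symm {χ ζ : DTerm A B C} : Equiv D χ ζ → Equiv D ζ χ
  | trans {χ ζ ξ : DTerm A B C} : Equiv D χ ζ → Equiv D ζ ξ → Equiv D χ ξ
  | parL_change {χ : DTerm A B C} {P Q : Proc A B C} :
      Dom D (.parL χ P) → Dom D (.parL χ Q) → Equiv D (.parL χ P) (.parL χ Q)
  | parR_change {χ : DTerm A B C} {P Q : Proc A B C} :
      Dom D (.parR P χ) → Dom D (.parR Q χ) → Equiv D (.parR P χ) (.parR Q χ)
  | broadcastL {χ ς : DTerm A B C} {P : Proc A B C} : χ.lab.IsBroadcast →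
      Dom D (.parB χ ς) → Dom D (.parL χ P) → Equiv D (.parB χ ς) (.parL χ P)
  | broadcastR {χ ς : DTerm A B C} {P : Proc A B C} : χ.lab.IsBroadcast →
      Dom D (.parB ς χ) → Dom D (.parR P χ) → Equiv D (.parB ς χ) (.parR P χ)
  | sumL {χ : DTerm A B C} {P : Proc A B C} :
      Dom D (.sumL χ P) → Dom D χ → Equiv D (.sumL χ P) χ
  | sumR {χ : DTerm A B C} {P : Proc A B C} :
      Dom D (.sumR P χ) → Dom D χ → Equiv D χ (.sumR P χ)
  | recu {χ : DTerm A B C} {a : A} : Dom D (.recu a χ) → Dom D χ → Equiv D (.recu a χ) χ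
  | res {χ ζ : DTerm A B C} {c : HS C} : Equiv D χ ζ →
      Dom D (.res χ c) → Dom D (.res ζ c) → Equiv D (.res χ c) (.res ζ c)
  | rel {χ ζ : DTerm A B C} {f : Relabelling B C} : Equiv D χ ζ →
      Dom D (.rel χ f) → Dom D (.rel ζ f) → Equiv D (.rel χ f) (.rel ζ f)
  | parL {χ ζ : DTerm A B C} {P : Proc A B C} : Equiv D χ ζ →
      Dom D (.parL χ P) → Dom D (.parL ζ P) → Equiv D (.parL χ P) (.parL ζ P)
  | parR {χ ζ : DTerm A B C} {P : Proc A B C} : Equiv D χ ζ →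
      Dom D (.parR P χ) → Dom D (.parR P ζ) → Equiv D (.parR P χ) (.parR P ζ)
  | parB {χ ζ ς ξ : DTerm A B C} : Equiv D χ ζ → Equiv D ς ξ →
      Dom D (.parB χ ς) → Dom D (.parB ζ ξ) → Equiv D (.parB χ ς) (.parB ζ ξ)

theorem Equiv.lab_eq {D : A → Proc A B C} {χ ζ : DTerm A B C} (h : Equiv D χ ζ) :
    χ.lab = ζ.lab := by
  induction h with
  | @broadcastL χ ς P hb h₁ _ =>
    obtain ⟨⟨_, _, _, h⟩, _⟩ := h₁
    obtain ⟨b, hb⟩ := hb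
    cases h with
    | comm c h₁ h₂ => rw [h₁.eq.2.1] at hb; cases hb
    | @broC _ _ _ _ _ _ s₁ s₂ s b h h₁ h₂ =>
      have e := h₁.eq.2.1
      simp only [DTerm.lab, h₂.eq.2.1]
      rw [hb] at e
      cases e
      rw [hb]
      cases s₂ <;> simp_all [Sharp.comp, Act.sync]
  | @broadcastR χ ς P hb h₁ _ =>
    obtain ⟨⟨_, _, _, h⟩, _⟩ := h₁
    obtain ⟨b, hb⟩ := hb
    cases h with
    | comm c h₁ h₂ => rw [h₂.eq.2.1] at hb; cases hb
    | @broC _ _ _ _ _ _ s₁ s₂ s b h h₁ h₂ =>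
      have e := h₂.eq.2.1
      simp only [DTerm.lab, h₁.eq.2.1]
      rw [hb] at e
      cases e
      rw [hb]
      cases s₁ <;> simp_all [Sharp.comp, Act.sync]
  | _ => simp_all [DTerm.lab]

/-- The setoid of derivations with non-receive labels modulo `≡`. -/
instance absSetoid (D : A → Proc A B C) : Setoid {χ : DTerm A B C // Dom D χ} where
  r χ ζ := Equiv D χ.1 ζ.1
  iseqv := ⟨fun χ => .refl χ.2, .symm, .trans⟩

/-- Abstract transitions: equivalence classes of derivations with non-receive labels. -/
def AbsTrans (D : A → Proc A B C) : Type (max u v w) := Quotient (absSetoid D)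

/-- The label of an abstract transition. -/
def AbsTrans.lab {D : A → Proc A B C} : AbsTrans D → Act B C :=
  Quotient.lift (fun χ => χ.1.lab) fun _ _ h => Equiv.lab_eq h

/-- `χ` is a representative of the abstract transition `ν`. -/
def AbsTrans.Rep {D : A → Proc A B C} (ν : AbsTrans D) (χ : DTerm A B C) : Prop :=
  ∃ h : Dom D χ, ν = Quotient.mk (absSetoid D) ⟨χ, h⟩

end Semantics

/-! ### Paths and linear-time temporal logic -/

/-- A path in a transition system with states `σ` and transitions `R`: a non-empty, finite or
infinite sequence of states, each related to the next, such that a finite path ends in a state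
satisfying `E`. The sequence is given by `st`, where `st n = none` means that it has at most `n`
elements. -/
@[ext]
structure Path {σ : Type u} (R : σ → σ → Prop) (E : σ → Prop) : Type u where
  st : ℕ → Option σ
  nonempty : (st 0).isSome
  closed : ∀ n, st n = none → st (n + 1) = none
  step : ∀ n s t, st n = some s → st (n + 1) = some t → R s t
  last : ∀ n s, st n = some s → st (n + 1) = none → E s

/-- The suffix of a path that starts at its `n`-th state. -/
def Path.suffix {σ : Type u} {R : σ → σ → Prop} {E : σ → Prop} (π : Path R E) (n : ℕ)
    (h : (π.st n).isSome) : Path R E where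
  st k := π.st (n + k)
  nonempty := h
  closed k := π.closed (n + k)
  step k := π.step (n + k)
  last k := π.last (n + k)

/-- The image of a path under a morphism of transition systems. -/
def Path.map {σ : Type u} {R : σ → σ → Prop} {E : σ → Prop} {τ : Type v} {R' : τ → τ → Prop}
    {E' : τ → Prop} (π : Path R E) (f : σ → τ) (hR : ∀ s t, R s t → R' (f s) (f t))
    (hE : ∀ s, E s → E' (f s)) : Path R' E' where
  st n := (π.st n).map f
  nonempty := by simpa using π.nonempty
  closed n h := by
    simp only [Option.map_eq_none_iff] at h ⊢
    exact π.closed n h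
  step n s t hs ht := by
    simp only [Option.map_eq_some_iff] at hs ht
    obtain ⟨s, hs, rfl⟩ := hs
    obtain ⟨t, ht, rfl⟩ := ht
    exact hR _ _ (π.step n s t hs ht)
  last n s hs ht := by
    simp only [Option.map_eq_some_iff, Option.map_eq_none_iff] at hs ht
    obtain ⟨s, hs, rfl⟩ := hs
    exact hE _ (π.last n s hs ht)

/-- Formulas of linear-time temporal logic over atomic propositions `AP`. -/
inductive LTL (AP : Type u) : Type u
  | atom (p : AP) : LTL AP
  | not (φ : LTL AP) : LTL AP
  | and (φ ψ : LTL AP) : LTL AP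
  | or (φ ψ : LTL AP) : LTL AP
  | imp (φ ψ : LTL AP) : LTL AP
  | X (φ : LTL AP) : LTL AP
  | G (φ : LTL AP) : LTL AP
  | F (φ : LTL AP) : LTL AP
  | U (φ ψ : LTL AP) : LTL AP

/-- Satisfaction of an LTL formula by a path; `val u p` says that the atomic proposition `p`
holds in the state `u`. -/
def Path.Sat {σ : Type u} {R : σ → σ → Prop} {E : σ → Prop} {AP : Type v}
    (val : σ → AP → Prop) : LTL AP → Path R E → Prop
  | .atom p, π => ∃ u, π.st 0 = some u ∧ val u p
  | .not φ, π => ¬ Path.Sat val φ π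
  | .and φ ψ, π => Path.Sat val φ π ∧ Path.Sat val ψ π
  | .or φ ψ, π => Path.Sat val φ π ∨ Path.Sat val ψ π
  | .imp φ ψ, π => Path.Sat val φ π → Path.Sat val ψ π
  | .X φ, π => ∃ h : (π.st 1).isSome, Path.Sat val φ (π.suffix 1 h)
  | .G φ, π => ∀ n, ∀ h : (π.st n).isSome, Path.Sat val φ (π.suffix n h)
  | .F φ, π => ∃ n, ∃ h : (π.st n).isSome, Path.Sat val φ (π.suffix n h)
  | .U φ ψ, π => ∃ n, ∃ h : (π.st n).isSome, Path.Sat val ψ (π.suffix n h) ∧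
      ∀ m, m < n → ∀ h' : (π.st m).isSome, Path.Sat val φ (π.suffix m h')

section Kripke

variable {A : Type u} {B : Type v} {C : Type w}

/-! ### The state-labelled transition system `S` -/

/-- States of `S`: processes, and transitions `P —α→ Q` of the labelled transition system. -/
inductive SState (D : A → Proc A B C) : Type (max u v w)
  | proc (P : Proc A B C) : SState D
  | trans (P : Proc A B C) (α : Act B C) (Q : Proc A B C) (h : Step D P α Q) : SState D

/-- Transitions of `S`: `P → (P —α→ Q)` and `(P —α→ Q) → Q`. -/
inductive SStep (D : A → Proc A B C) : SState D → SState D → Prop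
  | start {P α Q} (h : Step D P α Q) : SStep D (.proc P) (.trans P α Q h)
  | finish {P α Q} (h : Step D P α Q) : SStep D (.trans P α Q h) (.proc Q)

def SState.IsProc {D : A → Proc A B C} (s : SState D) : Prop := ∃ P, s = .proc P

/-- Paths in `S`; they are infinite or end in a process. -/
abbrev SPath (D : A → Proc A B C) : Type (max u v w) := Path (SStep D) SState.IsProc

/-! ### The Kripke structure `U` of derivations -/

/-- States of `U`: processes and derivations. -/
inductive UState (D : A → Proc A B C) : Type (max u v w)
  | proc (P : Proc A B C) : UState D
  | der (χ : DTerm A B C) (h : IsDer D χ) : UState D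

/-- Transitions of `U`: `P → χ` and `χ → Q` for `χ` a derivation of a transition `P —α→ Q`. -/
inductive UStep (D : A → Proc A B C) : UState D → UState D → Prop
  | start {χ} (h : IsDer D χ) : UStep D (.proc χ.src) (.der χ h)
  | finish {χ} (h : IsDer D χ) : UStep D (.der χ h) (.proc χ.tgt)

def UState.IsProc {D : A → Proc A B C} (s : UState D) : Prop := ∃ P, s = .proc P

/-- Paths in `U`; they are infinite or end in a process. -/
abbrev UPath (D : A → Proc A B C) : Type (max u v w) := Path (UStep D) UState.IsProc

/-- The projection of states of `U` to states of `S`. -/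
def UState.hat {D : A → Proc A B C} : UState D → SState D
  | .proc P => .proc P
  | .der χ h => .trans χ.src χ.lab χ.tgt ⟨χ, h.derives⟩

/-- The projection of paths in `U` to paths in `S`. -/
def UPath.hat {D : A → Proc A B C} (π : UPath D) : SPath D :=
  π.map UState.hat
    (by
      rintro _ _ (h | h)
      · exact .start _
      · exact .finish _)
    (by
      rintro _ ⟨P, rfl⟩
      exact ⟨P, rfl⟩)

/-- The atomic propositions `ν` ("`ν` occurs") and `en(ν)` ("`ν` is enabled") on `U`. -/
inductive AtProp (D : A → Proc A B C) : Type (max u v w)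
  | occurs (ν : AbsTrans D) : AtProp D
  | en (ν : AbsTrans D) : AtProp D

/-- Validity of atomic propositions in the states of `U`. -/
def UState.Holds {D : A → Proc A B C} : UState D → AtProp D → Prop
  | .proc _, .occurs _ => False
  | .der ζ _, .occurs ν => ν.Rep ζ
  | .proc P, .en ν => ∃ χ, ν.Rep χ ∧ P = χ.src
  | .der ζ _, .en ν => ∃ χ, ν.Rep χ ∧ Conc D χ ζ

/-- The justice (weak fairness) formula `F G en(ν) ⇒ G F ν`. -/
def justice {D : A → Proc A B C} (ν : AbsTrans D) : LTL (AtProp D) :=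
  .imp (.F (.G (.atom (.en ν)))) (.G (.F (.atom (.occurs ν))))

/-! ### Decomposition of paths in `S` -/

/-- `ParState s s₁ s₂`: the process or transition `s` of a parallel composition has the
decomposition `s₁`, `s₂`. A process `P|Q` decomposes into `P` and `Q`; a transition derived from
premises on one or both sides decomposes into these premises, together with the state of the idle
side, if any. -/
inductive ParState (D : A → Proc A B C) : SState D → SState D → SState D → Prop
  | proc (P Q : Proc A B C) : ParState D (.proc (.par P Q)) (.proc P) (.proc Q)
  | left {χ P α P' Q} (h₁ : Derives D χ P α P')
      (h : Derives D (.parL χ Q) (.par P Q) α (.par P' Q)) :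
      ParState D (.trans _ _ _ ⟨_, h⟩) (.trans _ _ _ ⟨_, h₁⟩) (.proc Q)
  | both {χ P α₁ P' ζ Q α₂ Q' α} (h₁ : Derives D χ P α₁ P') (h₂ : Derives D ζ Q α₂ Q')
      (h : Derives D (.parB χ ζ) (.par P Q) α (.par P' Q')) :
      ParState D (.trans _ _ _ ⟨_, h⟩) (.trans _ _ _ ⟨_, h₁⟩) (.trans _ _ _ ⟨_, h₂⟩)
  | right {ζ P Q α Q'} (h₂ : Derives D ζ Q α Q')
      (h : Derives D (.parR P ζ) (.par P Q) α (.par P Q')) :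
      ParState D (.trans _ _ _ ⟨_, h⟩) (.proc P) (.trans _ _ _ ⟨_, h₂⟩)

/-- `π ∈ π₁ | π₂`: the path `π` of a parallel composition is decomposed into `π₁` and `π₂`.
While the `m`-th state of `π` is visited, the components are in the `i m`-th state of `π₁` and the
`j m`-th state of `π₂`; the paths `π₁` and `π₂` contain nothing but the states so visited. -/
def ParDecomp {D : A → Proc A B C} (π π₁ π₂ : SPath D) : Prop :=
  ∃ i j : ℕ → ℕ, i 0 = 0 ∧ j 0 = 0 ∧
    (∀ m, i (m + 1) = i m ∨ i (m + 1) = i m + 1) ∧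
    (∀ m, j (m + 1) = j m ∨ j (m + 1) = j m + 1) ∧
    (∀ m s, π.st m = some s →
      ∃ s₁ s₂, π₁.st (i m) = some s₁ ∧ π₂.st (j m) = some s₂ ∧ ParState D s s₁ s₂) ∧
    (∀ k, (π₁.st k).isSome → ∃ m, (π.st m).isSome ∧ i m = k) ∧
    (∀ k, (π₂.st k).isSome → ∃ m, (π.st m).isSome ∧ j m = k)

/-- Decomposition of the processes `P\c` and their transitions. -/
inductive ResState (D : A → Proc A B C) (c : HS C) : SState D → SState D → Prop
  | proc (P : Proc A B C) : ResState D c (.proc (.res P c)) (.proc P)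
  | trans {P α P'} (h₁ : Step D P α P') (h : Step D (.res P c) α (.res P' c)) :
      ResState D c (.trans _ _ _ h) (.trans _ _ _ h₁)

/-- Decomposition of the processes `P[f]` and their transitions. -/
inductive RelState (D : A → Proc A B C) (f : Relabelling B C) : SState D → SState D → Prop
  | proc (P : Proc A B C) : RelState D f (.proc (.rel P f)) (.proc P)
  | trans {P α P'} (h₁ : Step D P α P') (h : Step D (.rel P f) (f.onAct α) (.rel P' f)) :
      RelState D f (.trans _ _ _ h) (.trans _ _ _ h₁)

/-- `π'` is a decomposition of the path `π` of a restricted process. -/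
def ResDecomp {D : A → Proc A B C} (c : HS C) (π π' : SPath D) : Prop :=
  ∀ n, Option.Rel (ResState D c) (π.st n) (π'.st n)

/-- `π'` is a decomposition of the path `π` of a relabelled process. -/
def RelDecomp {D : A → Proc A B C} (f : Relabelling B C) (π π' : SPath D) : Prop :=
  ∀ n, Option.Rel (RelState D f) (π.st n) (π'.st n)

/-! ### Justness -/

/-- The five requirements on a family of predicates, indexed by sets `Y` of handshake actions, on
the paths in `S`. -/
structure IsJustFamily {D : A → Proc A B C} (J : Set (HS C) → SPath D → Prop) : Prop where
  finite : ∀ Y π, J Y π → ∀ n s, π.st n = some s → π.st (n + 1) = none →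
    ∃ Q, s = .proc Q ∧ ∀ α R, Step D Q α R → (∃ c ∈ Y, α = .hs c) ∨ α.IsReceive
  par : ∀ Y π, J Y π → ∀ P Q, π.st 0 = some (.proc (.par P Q)) →
    ∃ X Z π₁ π₂, ParDecomp π π₁ π₂ ∧ J X π₁ ∧ J Z π₂ ∧ X ∪ Z ⊆ Y ∧ X ∩ HS.bar '' Z = ∅
  res : ∀ Y π, J Y π → ∀ P c, π.st 0 = some (.proc (.res P c)) →
    ∃ π', ResDecomp c π π' ∧ J (Y ∪ {c, c.bar}) π'
  rel : ∀ Y π, J Y π → ∀ P f, π.st 0 = some (.proc (.rel P f)) →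
    ∃ π', RelDecomp f π π' ∧ J (f.onHS ⁻¹' Y) π'
  suffix : ∀ Y π, J Y π → ∀ n, ∀ h : (π.st n).isSome, J Y (π.suffix n h)

/-- `Y`-justness: the union of all families of predicates that satisfy the five requirements. By
`isJustFamily_YJust` it satisfies them as well, so it is the largest such family. -/
def YJust {D : A → Proc A B C} (Y : Set (HS C)) (π : SPath D) : Prop :=
  ∃ J : Set (HS C) → SPath D → Prop, IsJustFamily J ∧ J Y π

theorem isJustFamily_YJust {D : A → Proc A B C} :
    IsJustFamily (fun Y (π : SPath D) => YJust Y π) where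
  finite := fun Y π ⟨_, hJ, h⟩ => hJ.finite Y π h
  par := fun Y π ⟨J, hJ, h⟩ P Q h0 => by
    obtain ⟨X, Z, π₁, π₂, hd, h₁, h₂, h₃⟩ := hJ.par Y π h P Q h0
    exact ⟨X, Z, π₁, π₂, hd, ⟨J, hJ, h₁⟩, ⟨J, hJ, h₂⟩, h₃⟩
  res := fun Y π ⟨J, hJ, h⟩ P c h0 => by
    obtain ⟨π', hd, h'⟩ := hJ.res Y π h P c h0
    exact ⟨π', hd, J, hJ, h'⟩
  rel := fun Y π ⟨J, hJ, h⟩ P f h0 => by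
    obtain ⟨π', hd, h'⟩ := hJ.rel Y π h P f h0
    exact ⟨π', hd, J, hJ, h'⟩
  suffix := fun Y π ⟨J, hJ, h⟩ n hn => ⟨J, hJ, hJ.suffix Y π h n hn⟩

/-- A path is just if it is `Y`-just for some set `Y` of handshake actions. -/
def Just {D : A → Proc A B C} (π : SPath D) : Prop := ∃ Y : Set (HS C), YJust Y π

end Kripke

end ABC

/-! An `≡`-class is determined by a finite tree, the `Shape` of its derivations: a parallel node
records which sides contribute to the action, and receivers of a broadcast leave no trace
(`equiv_iff`). Abstract transitions can thus be replaced by shapes. Concurrent derivations never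
have the same shape (`Conc.shape_ne`), so a shape is disabled at every derivation in which it
occurs. Hence `F G en(ν)` and `G F ν` exclude each other, and justice for `ν` just says that its
shape is not enabled forever from some point on (`sat_justice_iff`, `UPath.EvEn`).

This suggests a condition with a parameter `Y`, matching `Y`-justness: a path in `U` is `Fair Y` if
no shape labelled outside `Y` and the receive actions is enabled forever. For `Y` the set of all
handshake actions this is the condition of the theorem.

From fairness to justness, the projections of `Fair Y` paths form a family satisfying the five
clauses (`isJustFamily_fair`), hence lie in the largest one. The substantial clause is parallel
composition. Take for `X` and `Z` the handshake labels of shapes enabled forever on the left and on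
the right. A shape enabled forever in a component remains so in the composition, which puts `X` and
`Z` inside `Y`; complementary labels in `X` and `Z` would yield a `τ`-shape enabled forever.

From justness to fairness, derivations must be chosen so that the resulting path in `U` decomposes
exactly as the justness clauses decompose the path in `S`. One decomposition of each just path is
fixed (`JustPath.view`), and derivations are composed from those of the components by recursion on
position and process size (`JustPath.lift`). That the chosen path is fair follows by induction on
the shape (`JustPath.fair`). A shape enabled across a transition forces its target to be a static
process, so the path can be decomposed from there on. The shape then splits into smaller shapes
enabled forever in the components, one of which is still forbidden there. -/

namespace ABC

universe u v w

section Shapes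

variable {A : Type u} {B : Type v} {C : Type w}

/-! ### Shapes of derivations -/

/-- The shape of a derivation: what remains after forgetting discarded summands, unfoldings of
identifiers, idle components and the receivers of a broadcast. -/
inductive Shape (A : Type u) (B : Type v) (C : Type w) : Type (max u v w)
  | act (α : Act B C) (P : Proc A B C) : Shape A B C
  | left (x : Shape A B C) : Shape A B C
  | right (x : Shape A B C) : Shape A B C
  | both (x y : Shape A B C) : Shape A B C
  | res (x : Shape A B C) (c : HS C) : Shape A B C
  | rel (x : Shape A B C) (f : Relabelling B C) : Shape A B C

/-- The label of a shape. -/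
def Shape.lab : Shape A B C → Act B C
  | .act α _ => α
  | .left x => x.lab
  | .right x => x.lab
  -- `both` stands for handshakes only: of a broadcast synchronisation just the sender is kept.
  | .both _ _ => .tau
  | .res x _ => x.lab
  | .rel x f => f.onAct x.lab

open Classical in
/-- The shape of a derivation. -/
noncomputable def DTerm.shape : DTerm A B C → Shape A B C
  | .act α P => .act α P
  | .sumL χ _ => χ.shape
  | .sumR _ χ => χ.shape
  | .parL χ _ => .left χ.shape
  | .parR _ χ => .right χ.shape
  | .parB χ ζ =>
    -- If neither side broadcasts, the derivation is a handshake or a joint reception. The latter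
    -- lies outside `Dom`, so its shape plays no role.
    if χ.lab.IsBroadcast then .left χ.shape
    else if ζ.lab.IsBroadcast then .right ζ.shape
    else .both χ.shape ζ.shape
  | .res χ c => .res χ.shape c
  | .rel χ f => .rel χ.shape f
  | .recu _ χ => χ.shape

theorem DTerm.shape_parL (χ : DTerm A B C) (Q : Proc A B C) :
    (DTerm.parL χ Q).shape = .left χ.shape := rfl

theorem DTerm.shape_parR (P : Proc A B C) (χ : DTerm A B C) :
    (DTerm.parR P χ).shape = .right χ.shape := rfl

/-- A derivation of the given shape, in which all idle components are inactive. -/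
def Shape.canon : Shape A B C → DTerm A B C
  | .act α P => .act α P
  | .left x => .parL x.canon .nil
  | .right x => .parR .nil x.canon
  | .both x y => .parB x.canon y.canon
  | .res x c => .res x.canon c
  | .rel x f => .rel x.canon f

theorem Relabelling.isReceive_onAct {f : Relabelling B C} {α : Act B C} :
    (f.onAct α).IsReceive ↔ α.IsReceive := by
  constructor
  · rintro ⟨b, h⟩
    cases α <;> simp [onAct] at h
    exact ⟨_, by rw [h.1]⟩
  · rintro ⟨b, rfl⟩
    exact ⟨_, rfl⟩

theorem Act.not_isBroadcast_of_isReceive {α : Act B C} (h : α.IsReceive) : ¬ α.IsBroadcast := by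
  obtain ⟨b, rfl⟩ := h
  rintro ⟨_, h⟩
  cases h

theorem HS.bar_bar (c : HS C) : c.bar.bar = c := by cases c <;> rfl

/-! ### Inversion of the operational rules on derivation names -/

section Inversion

variable {D : A → Proc A B C} {χ ζ : DTerm A B C} {P Q : Proc A B C}

theorem isDer_sumL : IsDer D (.sumL χ Q) ↔ IsDer D χ := by
  constructor
  · rintro ⟨_, _, _, h⟩
    cases h with | sumL _ h => exact ⟨_, _, _, h⟩
  · exact fun h => ⟨_, _, _, .sumL Q h.derives⟩

theorem isDer_sumR : IsDer D (.sumR P χ) ↔ IsDer D χ := by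
  constructor
  · rintro ⟨_, _, _, h⟩
    cases h with | sumR _ h => exact ⟨_, _, _, h⟩
  · exact fun h => ⟨_, _, _, .sumR P h.derives⟩

theorem isDer_recu {a : A} : IsDer D (.recu a χ) ↔ IsDer D χ ∧ χ.src = D a := by
  constructor
  · rintro ⟨_, _, _, h⟩
    cases h with | recu _ h => exact ⟨⟨_, _, _, h⟩, h.eq.1⟩
  · exact fun h => ⟨_, _, _, .recu a (h.2 ▸ h.1.derives)⟩

theorem isDer_rel {f : Relabelling B C} : IsDer D (.rel χ f) ↔ IsDer D χ := by
  constructor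
  · rintro ⟨_, _, _, h⟩
    cases h with | rel _ h => exact ⟨_, _, _, h⟩
  · exact fun h => ⟨_, _, _, .rel f h.derives⟩

theorem isDer_res {c : HS C} :
    IsDer D (.res χ c) ↔ IsDer D χ ∧ χ.lab ≠ .hs c ∧ χ.lab ≠ .hs c.bar := by
  constructor
  · rintro ⟨_, _, _, h⟩
    cases h with
    | res _ h₁ h₂ h =>
      rw [h.eq.2.1]
      exact ⟨⟨_, _, _, h⟩, h₁, h₂⟩
  · exact fun h => ⟨_, _, _, .res c h.2.1 h.2.2 h.1.derives⟩

/-- A process can stay idle during an action unless it can receive a message broadcast by it. -/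
def CanIdle (D : A → Proc A B C) (α : Act B C) (Q : Proc A B C) : Prop :=
  ∀ s b, α = .bc s b → ¬ Receives D Q b

theorem isDer_parL : IsDer D (.parL χ Q) ↔ IsDer D χ ∧ CanIdle D χ.lab Q := by
  constructor
  · rintro ⟨_, _, _, h⟩
    cases h with
    | parL _ hη h =>
      refine ⟨⟨_, _, _, h⟩, ?_⟩
      rw [h.eq.2.1]
      rintro s b rfl
      simp [Act.IsEta] at hη
    | broL h hQ =>
      refine ⟨⟨_, _, _, h⟩, ?_⟩
      rw [h.eq.2.1]
      intro s b e
      cases e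
      exact hQ
  · rintro ⟨h, hQ⟩
    have h' := h.derives
    generalize χ.lab = α at h' hQ
    cases α with
    | bc s b => exact ⟨_, _, _, .broL h' (hQ s b rfl)⟩
    | hs c => exact ⟨_, _, _, .parL Q (.inl ⟨c, rfl⟩) h'⟩
    | tau => exact ⟨_, _, _, .parL Q (.inr rfl) h'⟩

theorem isDer_parR : IsDer D (.parR P χ) ↔ IsDer D χ ∧ CanIdle D χ.lab P := by
  constructor
  · rintro ⟨_, _, _, h⟩
    cases h with
    | parR _ hη h =>
      refine ⟨⟨_, _, _, h⟩, ?_⟩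
      rw [h.eq.2.1]
      rintro s b rfl
      simp [Act.IsEta] at hη
    | broR hQ h =>
      refine ⟨⟨_, _, _, h⟩, ?_⟩
      rw [h.eq.2.1]
      intro s b e
      cases e
      exact hQ
  · rintro ⟨h, hQ⟩
    have h' := h.derives
    generalize χ.lab = α at h' hQ
    cases α with
    | bc s b => exact ⟨_, _, _, .broR (hQ s b rfl) h'⟩
    | hs c => exact ⟨_, _, _, .parR P (.inl ⟨c, rfl⟩) h'⟩
    | tau => exact ⟨_, _, _, .parR P (.inr rfl) h'⟩

/-- The actions `α` and `β` of two components can synchronise. -/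
def CanSync (α β : Act B C) : Prop :=
  (∃ c, α = .hs c ∧ β = .hs c.bar) ∨ ∃ s₁ s₂ s b, Sharp.comp s₁ s₂ = some s ∧
    α = .bc s₁ b ∧ β = .bc s₂ b

theorem isDer_parB : IsDer D (.parB χ ζ) ↔ IsDer D χ ∧ IsDer D ζ ∧ CanSync χ.lab ζ.lab := by
  constructor
  · rintro ⟨_, _, _, h⟩
    cases h with
    | comm c h₁ h₂ =>
      exact ⟨⟨_, _, _, h₁⟩, ⟨_, _, _, h₂⟩, .inl ⟨c, h₁.eq.2.1, h₂.eq.2.1⟩⟩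
    | broC h h₁ h₂ =>
      exact ⟨⟨_, _, _, h₁⟩, ⟨_, _, _, h₂⟩, .inr ⟨_, _, _, _, h, h₁.eq.2.1, h₂.eq.2.1⟩⟩
  · rintro ⟨h₁, h₂, ⟨c, e₁, e₂⟩ | ⟨s₁, s₂, s, b, h, e₁, e₂⟩⟩
    · exact ⟨_, _, _, .comm c (e₁ ▸ h₁.derives) (e₂ ▸ h₂.derives)⟩
    · exact ⟨_, _, _, .broC h (e₁ ▸ h₁.derives) (e₂ ▸ h₂.derives)⟩

theorem dom_sumL : Dom D (.sumL χ Q) ↔ Dom D χ := and_congr_left' isDer_sumL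

theorem dom_sumR : Dom D (.sumR P χ) ↔ Dom D χ := and_congr_left' isDer_sumR

theorem dom_recu {a : A} : Dom D (.recu a χ) ↔ Dom D χ ∧ χ.src = D a := by
  simp only [Dom, isDer_recu, DTerm.lab]
  tauto

theorem dom_rel {f : Relabelling B C} : Dom D (.rel χ f) ↔ Dom D χ := by
  simp only [Dom, isDer_rel, DTerm.lab, Relabelling.isReceive_onAct]

theorem dom_res {c : HS C} :
    Dom D (.res χ c) ↔ Dom D χ ∧ χ.lab ≠ .hs c ∧ χ.lab ≠ .hs c.bar := by
  simp only [Dom, isDer_res, DTerm.lab]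
  tauto

theorem dom_parL : Dom D (.parL χ Q) ↔ Dom D χ ∧ CanIdle D χ.lab Q := by
  simp only [Dom, isDer_parL, DTerm.lab]
  tauto

theorem dom_parR : Dom D (.parR P χ) ↔ Dom D χ ∧ CanIdle D χ.lab P := by
  simp only [Dom, isDer_parR, DTerm.lab]
  tauto

/-- The three ways to synchronise into an action that is not a receive action. -/
theorem Dom.parB_cases (h : Dom D (.parB χ ζ)) :
    (χ.lab.IsBroadcast ∧ ζ.lab.IsReceive ∧ Dom D χ ∧ (DTerm.parB χ ζ).shape = .left χ.shape) ∨
    (χ.lab.IsReceive ∧ ζ.lab.IsBroadcast ∧ Dom D ζ ∧ (DTerm.parB χ ζ).shape = .right ζ.shape) ∨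
    ((∃ c, χ.lab = .hs c ∧ ζ.lab = .hs c.bar) ∧ Dom D χ ∧ Dom D ζ ∧
      (DTerm.parB χ ζ).shape = .both χ.shape ζ.shape) := by
  obtain ⟨h, hr⟩ := h
  obtain ⟨h₁, h₂, ⟨c, e₁, e₂⟩ | ⟨s₁, s₂, s, b, h, e₁, e₂⟩⟩ := isDer_parB.1 h
  · refine .inr (.inr ⟨⟨c, e₁, e₂⟩, ⟨h₁, ?_⟩, ⟨h₂, ?_⟩, ?_⟩) <;>
      simp [e₁, e₂, DTerm.shape, Act.IsReceive, Act.IsBroadcast]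
  · cases s₁ <;> cases s₂ <;> simp [Sharp.comp] at h
    · refine .inl ⟨⟨b, e₁⟩, ⟨b, e₂⟩, ⟨h₁, ?_⟩, ?_⟩ <;>
        simp [e₁, DTerm.shape, Act.IsReceive, Act.IsBroadcast]
    · refine .inr (.inl ⟨⟨b, e₁⟩, ⟨b, e₂⟩, ⟨h₂, ?_⟩, ?_⟩) <;>
        simp [e₁, e₂, DTerm.shape, Act.IsReceive, Act.IsBroadcast]
    · refine absurd ⟨b, ?_⟩ hr
      simp [DTerm.lab, e₁, e₂, Act.sync, Sharp.comp]

theorem dom_parB_of_hs {c : HS C} (h₁ : IsDer D χ) (h₂ : IsDer D ζ) (e₁ : χ.lab = .hs c)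
    (e₂ : ζ.lab = .hs c.bar) : Dom D (.parB χ ζ) := by
  refine ⟨isDer_parB.2 ⟨h₁, h₂, .inl ⟨c, e₁, e₂⟩⟩, ?_⟩
  simp [DTerm.lab, e₁, e₂, Act.sync, Act.IsReceive]

theorem canIdle_nil (α : Act B C) : CanIdle D α .nil := by
  rintro s b - ⟨⟩

end Inversion

/-! ### Abstract transitions as shapes -/

variable {D : A → Proc A B C}

theorem Equiv.dom {χ ζ : DTerm A B C} (h : Equiv D χ ζ) : Dom D χ ∧ Dom D ζ := by
  induction h <;> simp_all

/-- Everything that the shape forgets can be changed by a clause of `≡`. Idle components and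
receivers are replaced by `nil`, which receives nothing and so may idle next to any action; this
keeps all intermediate terms derivations. -/
theorem Equiv.canon_shape {χ : DTerm A B C} (h : Dom D χ) : Equiv D χ χ.shape.canon := by
  induction χ with
  | act α P => exact .refl h
  | sumL χ Q ih => exact .trans (.sumL h (dom_sumL.1 h)) (ih (dom_sumL.1 h))
  | sumR P χ ih => exact .trans (.symm (.sumR h (dom_sumR.1 h))) (ih (dom_sumR.1 h))
  | recu a χ ih => exact .trans (.recu h (dom_recu.1 h).1) (ih (dom_recu.1 h).1)
  | parL χ Q ih =>
    have h' := (dom_parL.1 h).1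
    have h₀ : Dom D (.parL χ .nil) := dom_parL.2 ⟨h', canIdle_nil _⟩
    exact .trans (.parL_change h h₀)
      (.parL (ih h') h₀ (dom_parL.2 ⟨(ih h').dom.2, canIdle_nil _⟩))
  | parR P χ ih =>
    have h' := (dom_parR.1 h).1
    have h₀ : Dom D (.parR .nil χ) := dom_parR.2 ⟨h', canIdle_nil _⟩
    exact .trans (.parR_change h h₀)
      (.parR (ih h') h₀ (dom_parR.2 ⟨(ih h').dom.2, canIdle_nil _⟩))
  | parB χ ζ ih₁ ih₂ =>
    obtain ⟨hb, -, h', e⟩ | ⟨-, hb, h', e⟩ | ⟨⟨c, e₁, e₂⟩, h₁, h₂, e⟩ := h.parB_cases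
    · rw [e]
      have h₀ : Dom D (.parL χ .nil) := dom_parL.2 ⟨h', canIdle_nil _⟩
      exact .trans (.broadcastL hb h h₀)
        (.parL (ih₁ h') h₀ (dom_parL.2 ⟨(ih₁ h').dom.2, canIdle_nil _⟩))
    · rw [e]
      have h₀ : Dom D (.parR .nil ζ) := dom_parR.2 ⟨h', canIdle_nil _⟩
      exact .trans (.broadcastR hb h h₀)
        (.parR (ih₂ h') h₀ (dom_parR.2 ⟨(ih₂ h').dom.2, canIdle_nil _⟩))
    · rw [e]
      have h₁' := ih₁ h₁
      have h₂' := ih₂ h₂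
      exact .parB h₁' h₂' h (dom_parB_of_hs h₁'.dom.2.1 h₂'.dom.2.1
        (h₁'.lab_eq ▸ e₁) (h₂'.lab_eq ▸ e₂))
  | res χ c ih =>
    have h' := dom_res.1 h
    exact .res (ih h'.1) h (dom_res.2 ⟨(ih h'.1).dom.2, (ih h'.1).lab_eq ▸ h'.2⟩)
  | rel χ f ih =>
    have h' := dom_rel.1 h
    exact .rel (ih h') h (dom_rel.2 (ih h').dom.2)

theorem Equiv.shape_eq {χ ζ : DTerm A B C} (h : Equiv D χ ζ) : χ.shape = ζ.shape := by
  induction h with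
  | refl => rfl
  | symm _ ih => exact ih.symm
  | trans _ _ ih₁ ih₂ => exact ih₁.trans ih₂
  | broadcastL hb => simp [DTerm.shape, hb]
  | broadcastR hb h =>
    obtain ⟨-, hr, -⟩ | ⟨-, -, -, e⟩ | ⟨⟨c, e₁, e₂⟩, -⟩ := h.parB_cases
    · exact absurd hb (Act.not_isBroadcast_of_isReceive hr)
    · exact e
    · obtain ⟨b, hb⟩ := hb
      rw [hb] at e₂
      cases e₂
  | parB h₁ h₂ _ _ ih₁ ih₂ =>
    simp only [DTerm.shape]
    rw [ih₁, ih₂, h₁.lab_eq, h₂.lab_eq]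
  | _ => simp_all [DTerm.shape]

/-- Two derivations are equivalent if and only if they have the same shape. -/
theorem equiv_iff {χ ζ : DTerm A B C} (h : Dom D χ) (h' : Dom D ζ) :
    Equiv D χ ζ ↔ χ.shape = ζ.shape :=
  ⟨Equiv.shape_eq, fun e => .trans (.canon_shape h) (e ▸ .symm (.canon_shape h'))⟩

/-- The restriction to `Dom` is essential: a joint reception also has a shape `both`, whose label is
`τ`. -/
theorem Dom.lab_shape {χ : DTerm A B C} (h : Dom D χ) : χ.shape.lab = χ.lab := by
  induction χ with
  | act α P => rfl
  | sumL χ Q ih => exact ih (dom_sumL.1 h)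
  | sumR P χ ih => exact ih (dom_sumR.1 h)
  | recu a χ ih => exact ih (dom_recu.1 h).1
  | parL χ Q ih => exact ih (dom_parL.1 h).1
  | parR P χ ih => exact ih (dom_parR.1 h).1
  | parB χ ζ ih₁ ih₂ =>
    obtain ⟨hb, -, h', e⟩ | ⟨-, hb, h', e⟩ | ⟨⟨c, e₁, e₂⟩, h₁, h₂, e⟩ := h.parB_cases
    · rw [e]
      exact (ih₁ h').trans (Equiv.lab_eq (.broadcastL (P := .nil) hb h
        (dom_parL.2 ⟨h', canIdle_nil _⟩))).symm
    · rw [e]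
      exact (ih₂ h').trans (Equiv.lab_eq (.broadcastR (P := .nil) hb h
        (dom_parR.2 ⟨h', canIdle_nil _⟩))).symm
    · rw [e]
      simp [Shape.lab, DTerm.lab, e₁, e₂, Act.sync]
  | res χ c ih => exact ih (dom_res.1 h).1
  | rel χ f ih => exact congrArg f.onAct (ih (dom_rel.1 h))

/-- From here on, shapes take the place of equivalence classes. -/
theorem AbsTrans.rep_iff {χ₀ : {χ : DTerm A B C // Dom D χ}} {χ : DTerm A B C} :
    AbsTrans.Rep (Quotient.mk (absSetoid D) χ₀ : AbsTrans D) χ ↔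
      Dom D χ ∧ χ.shape = χ₀.1.shape := by
  constructor
  · rintro ⟨h, e⟩
    exact ⟨h, (Equiv.shape_eq (Quotient.exact e)).symm⟩
  · rintro ⟨h, e⟩
    exact ⟨h, Quotient.sound ((equiv_iff χ₀.2 h).2 e.symm)⟩

end Shapes

section Concurrency

variable {A : Type u} {B : Type v} {C : Type w}

/-! ### Enabledness of shapes -/

section Enabled

variable {D : A → Proc A B C}

/-- Processes whose outermost operator is a parallel composition, restriction or relabelling. -/
def Proc.IsStatic : Proc A B C → Prop
  | .par _ _ => True
  | .res _ _ => True
  | .rel _ _ => True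
  | _ => False

/-- The shape `x` is enabled in a state of `U`. -/
def UState.En (x : Shape A B C) : UState D → Prop
  | .proc P => ∃ χ, Dom D χ ∧ χ.shape = x ∧ χ.src = P
  | .der ζ _ => ∃ χ, Dom D χ ∧ χ.shape = x ∧ Conc D χ ζ

theorem UState.holds_en_iff {χ₀ : {χ : DTerm A B C // Dom D χ}} {s : UState D} :
    s.Holds (.en (Quotient.mk (absSetoid D) χ₀)) ↔ s.En χ₀.1.shape := by
  cases s with
  | proc P =>
    simp only [Holds, En, AbsTrans.rep_iff]
    exact exists_congr fun χ => by rw [and_assoc, eq_comm (a := P)]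
  | der ζ h =>
    simp only [Holds, En, AbsTrans.rep_iff]
    exact exists_congr fun χ => by rw [and_assoc]

/-- Concurrency originates at a parallel composition. The static operators survive in the target,
while sums and identifiers pass on the target of their premise. This is what makes a path
decomposable once a shape has stayed enabled across a transition. -/
theorem Conc.isStatic_tgt {χ ζ : DTerm A B C} (h : Conc D χ ζ) : ζ.tgt.IsStatic := by
  induction h <;> simp_all [DTerm.tgt, Proc.IsStatic]

/-- A bare prefix has no component that could move independently of it. Sums and identifiers leave
the shape unchanged; every other clause puts a static node on top of it. -/
theorem Conc.shape_ne_act {χ ζ : DTerm A B C} (h : Conc D χ ζ) (hχ : Dom D χ) (α : Act B C)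
    (P : Proc A B C) : χ.shape ≠ .act α P := by
  induction h with
  | sumL _ _ _ ih => exact ih (dom_sumL.1 hχ)
  | sumR _ _ _ ih => exact ih (dom_sumR.1 hχ)
  | recu _ _ _ ih => exact ih (dom_recu.1 hχ).1
  | both_right | both_left | parB_parL | parB_parR | parB_receiveR | parB_receiveL | parB =>
    obtain ⟨-, -, -, e⟩ | ⟨-, -, -, e⟩ | ⟨-, -, -, e⟩ := hχ.parB_cases <;> simp [e]
  | _ => simp [DTerm.shape]

theorem UState.not_en_act {ζ : DTerm A B C} {h : IsDer D ζ} {α : Act B C} {P : Proc A B C} :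
    ¬ (UState.der ζ h).En (.act α P) := by
  rintro ⟨χ, hχ, e, hc⟩
  exact hc.shape_ne_act hχ _ _ e

/-- Either the roots of the two shapes differ, or the shapes share a branch on which the derivations
are again concurrent. A component of `χ` that only receives leaves no branch in its shape, so the
lack of concurrency there does no harm. -/
theorem Conc.shape_ne {χ ζ : DTerm A B C} (h : Conc D χ ζ) (hχ : Dom D χ) (hζ : Dom D ζ) :
    χ.shape ≠ ζ.shape := by
  induction h with
  | left_right | right_left => simp [DTerm.shape]
  | sumL _ _ _ ih => exact ih (dom_sumL.1 hχ) (dom_sumL.1 hζ)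
  | sumR _ _ _ ih => exact ih (dom_sumR.1 hχ) (dom_sumR.1 hζ)
  | recu _ _ _ ih => exact ih (dom_recu.1 hχ).1 (dom_recu.1 hζ).1
  | parL _ _ _ ih => simpa [DTerm.shape] using ih (dom_parL.1 hχ).1 (dom_parL.1 hζ).1
  | parR _ _ _ ih => simpa [DTerm.shape] using ih (dom_parR.1 hχ).1 (dom_parR.1 hζ).1
  | res _ _ _ ih => simpa [DTerm.shape] using ih (dom_res.1 hχ).1 (dom_res.1 hζ).1
  | rel _ _ _ ih => simpa [DTerm.shape] using ih (dom_rel.1 hχ) (dom_rel.1 hζ)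
  | both_right _ _ _ _ hr =>
    obtain ⟨-, -, -, e⟩ | ⟨-, hb, -, e⟩ | ⟨-, -, -, e⟩ := hχ.parB_cases <;>
      simp [e, DTerm.shape_parR]
    exact absurd hb (Act.not_isBroadcast_of_isReceive hr)
  | both_left _ _ _ _ hr =>
    obtain ⟨hb, -, -, e⟩ | ⟨-, -, -, e⟩ | ⟨-, -, -, e⟩ := hχ.parB_cases <;>
      simp [e, DTerm.shape_parL]
    exact absurd hb (Act.not_isBroadcast_of_isReceive hr)
  | parL_parB _ _ _ _ ih =>
    have h' := (dom_parL.1 hχ).1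
    obtain ⟨-, -, h₁, e⟩ | ⟨-, -, -, e⟩ | ⟨-, -, -, e⟩ := hζ.parB_cases <;>
      simp [e, DTerm.shape_parL]
    exact ih h' h₁
  | parR_parB _ _ _ _ ih =>
    have h' := (dom_parR.1 hχ).1
    obtain ⟨-, -, -, e⟩ | ⟨-, -, h₁, e⟩ | ⟨-, -, -, e⟩ := hζ.parB_cases <;>
      simp [e, DTerm.shape_parR]
    exact ih h' h₁
  | parB_parL _ _ _ _ ih =>
    have h' := (dom_parL.1 hζ).1
    obtain ⟨-, -, h₁, e⟩ | ⟨-, -, -, e⟩ | ⟨-, -, -, e⟩ := hχ.parB_cases <;>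
      simp [e, DTerm.shape_parL]
    exact ih h₁ h'
  | parB_parR _ _ _ _ ih =>
    have h' := (dom_parR.1 hζ).1
    obtain ⟨-, -, -, e⟩ | ⟨-, -, h₁, e⟩ | ⟨-, -, -, e⟩ := hχ.parB_cases <;>
      simp [e, DTerm.shape_parR]
    exact ih h₁ h'
  | parB_receiveR _ _ hr _ _ ih =>
    obtain ⟨-, -, h₁, e⟩ | ⟨-, hb, -, e⟩ | ⟨⟨c, -, hb⟩, -⟩ := hχ.parB_cases
    · obtain ⟨-, -, h₂, e'⟩ | ⟨-, -, -, e'⟩ | ⟨-, -, -, e'⟩ := hζ.parB_cases <;> simp [e, e']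
      exact ih h₁ h₂
    · exact absurd hb (Act.not_isBroadcast_of_isReceive hr)
    · simp [hb, Act.IsReceive] at hr
  | parB_receiveL _ _ hr _ _ ih =>
    obtain ⟨hb, -⟩ | ⟨-, -, h₁, e⟩ | ⟨⟨c, hb, -⟩, -⟩ := hχ.parB_cases
    · exact absurd hb (Act.not_isBroadcast_of_isReceive hr)
    · obtain ⟨-, -, -, e'⟩ | ⟨-, -, h₂, e'⟩ | ⟨-, -, -, e'⟩ := hζ.parB_cases <;> simp [e, e']
      exact ih h₁ h₂
    · simp [hb, Act.IsReceive] at hr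
  | parB _ _ _ _ ih₁ ih₂ =>
    obtain ⟨-, -, h₁, e⟩ | ⟨-, -, h₁, e⟩ | ⟨-, h₁, h₁', e⟩ := hχ.parB_cases <;>
    obtain ⟨-, -, h₂, e'⟩ | ⟨-, -, h₂, e'⟩ | ⟨-, h₂, h₂', e'⟩ := hζ.parB_cases <;> simp [e, e']
    · exact ih₁ h₁ h₂
    · exact ih₂ h₁ h₂
    · exact fun e => absurd e (ih₁ h₁ h₂)

/-- A shape is not enabled while it occurs. -/
theorem UState.not_en_shape {ζ : DTerm A B C} {h : IsDer D ζ} (hζ : Dom D ζ) :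
    ¬ (UState.der ζ h).En ζ.shape := by
  rintro ⟨χ, hχ, e, hc⟩
  exact hc.shape_ne hχ hζ e

theorem UState.En.dom {x : Shape A B C} {s : UState D} (h : s.En x) :
    ∃ χ : DTerm A B C, Dom D χ ∧ χ.shape = x := by
  cases s <;> obtain ⟨χ, h, e, -⟩ := h <;> exact ⟨χ, h, e⟩

theorem UState.En.not_isReceive {x : Shape A B C} {s : UState D} (h : s.En x) :
    ¬ x.lab.IsReceive := by
  obtain ⟨χ, hχ, rfl⟩ := h.dom
  rw [hχ.lab_shape]
  exact hχ.2

/-! ### Decomposition of the states of `U` -/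

/-- Decomposition of the processes `P|Q` and their derivations. -/
inductive UPar (D : A → Proc A B C) : UState D → UState D → UState D → Prop
  | proc (P Q : Proc A B C) : UPar D (.proc (.par P Q)) (.proc P) (.proc Q)
  | left {χ Q} (h₁ : IsDer D χ) (h : IsDer D (.parL χ Q)) :
      UPar D (.der _ h) (.der _ h₁) (.proc Q)
  | both {χ ζ} (h₁ : IsDer D χ) (h₂ : IsDer D ζ) (h : IsDer D (.parB χ ζ)) :
      UPar D (.der _ h) (.der _ h₁) (.der _ h₂)
  | right {ζ P} (h₂ : IsDer D ζ) (h : IsDer D (.parR P ζ)) :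
      UPar D (.der _ h) (.proc P) (.der _ h₂)

/-- Decomposition of the processes `P\c` and their derivations. -/
inductive URes (D : A → Proc A B C) (c : HS C) : UState D → UState D → Prop
  | proc (P : Proc A B C) : URes D c (.proc (.res P c)) (.proc P)
  | der {χ} (h₁ : IsDer D χ) (h : IsDer D (.res χ c)) : URes D c (.der _ h) (.der _ h₁)

/-- Decomposition of the processes `P[f]` and their derivations. -/
inductive URel (D : A → Proc A B C) (f : Relabelling B C) : UState D → UState D → Prop
  | proc (P : Proc A B C) : URel D f (.proc (.rel P f)) (.proc P)
  | der {χ} (h₁ : IsDer D χ) (h : IsDer D (.rel χ f)) : URel D f (.der _ h) (.der _ h₁)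

theorem URes.en {c : HS C} {s s' : UState D} (h : URes D c s s') {x : Shape A B C} (hx : s.En x) :
    ∃ y, x = .res y c ∧ y.lab ≠ .hs c ∧ y.lab ≠ .hs c.bar ∧ s'.En y := by
  cases h with
  | proc P =>
    obtain ⟨χ, hχ, rfl, hs⟩ := hx
    cases χ <;> simp [DTerm.src] at hs
    obtain ⟨rfl, rfl⟩ := hs
    obtain ⟨h, h'⟩ := dom_res.1 hχ
    exact ⟨_, rfl, h.lab_shape ▸ h'.1, h.lab_shape ▸ h'.2, _, h, rfl, rfl⟩
  | der _ _ =>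
    obtain ⟨χ, hχ, rfl, hc⟩ := hx
    cases hc with
    | res hc =>
      obtain ⟨h, h'⟩ := dom_res.1 hχ
      exact ⟨_, rfl, h.lab_shape ▸ h'.1, h.lab_shape ▸ h'.2, _, h, rfl, hc⟩

theorem URes.en_res {c : HS C} {s s' : UState D} (h : URes D c s s') {y : Shape A B C}
    (h₁ : y.lab ≠ .hs c) (h₂ : y.lab ≠ .hs c.bar) (hy : s'.En y) : s.En (.res y c) := by
  cases h with
  | proc P =>
    obtain ⟨χ, hχ, rfl, rfl⟩ := hy
    rw [hχ.lab_shape] at h₁ h₂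
    exact ⟨.res χ c, dom_res.2 ⟨hχ, h₁, h₂⟩, rfl, rfl⟩
  | der _ h' =>
    obtain ⟨χ, hχ, rfl, hc⟩ := hy
    rw [hχ.lab_shape] at h₁ h₂
    exact ⟨.res χ c, dom_res.2 ⟨hχ, h₁, h₂⟩, rfl, .res hc (isDer_res.2 ⟨hχ.1, h₁, h₂⟩) h'⟩

theorem URel.en {f : Relabelling B C} {s s' : UState D} (h : URel D f s s') {x : Shape A B C}
    (hx : s.En x) : ∃ y, x = .rel y f ∧ s'.En y := by
  cases h with
  | proc P =>
    obtain ⟨χ, hχ, rfl, hs⟩ := hx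
    cases χ <;> simp [DTerm.src] at hs
    obtain ⟨rfl, rfl⟩ := hs
    exact ⟨_, rfl, _, dom_rel.1 hχ, rfl, rfl⟩
  | der _ _ =>
    obtain ⟨χ, hχ, rfl, hc⟩ := hx
    cases hc with
    | rel hc => exact ⟨_, rfl, _, dom_rel.1 hχ, rfl, hc⟩

theorem URel.en_rel {f : Relabelling B C} {s s' : UState D} (h : URel D f s s')
    {y : Shape A B C} (hy : s'.En y) : s.En (.rel y f) := by
  cases h with
  | proc P =>
    obtain ⟨χ, hχ, rfl, rfl⟩ := hy
    exact ⟨.rel χ f, dom_rel.2 hχ, rfl, rfl⟩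
  | der _ h' =>
    obtain ⟨χ, hχ, rfl, hc⟩ := hy
    exact ⟨.rel χ f, dom_rel.2 hχ, rfl, .rel hc (isDer_rel.2 hχ.1) h'⟩

/-- A shape enabled in a parallel composition is enabled in the components that it involves. -/
theorem UPar.en {s s₁ s₂ : UState D} (h : UPar D s s₁ s₂) {x : Shape A B C} (hx : s.En x) :
    (∃ y, x = .left y ∧ s₁.En y) ∨ (∃ z, x = .right z ∧ s₂.En z) ∨
      ∃ y z c, x = .both y z ∧ y.lab = .hs c ∧ z.lab = .hs c.bar ∧ s₁.En y ∧ s₂.En z := by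
  -- Uniform treatment of synchronisations: only the sender of a broadcast, or both partners of a
  -- handshake, must be shown enabled.
  have key : ∀ {χ ζ : DTerm A B C}, Dom D (.parB χ ζ) → (DTerm.parB χ ζ).shape = x →
      (χ.lab.IsBroadcast → ζ.lab.IsReceive → Dom D χ → s₁.En χ.shape) →
      (χ.lab.IsReceive → ζ.lab.IsBroadcast → Dom D ζ → s₂.En ζ.shape) →
      (∀ c, χ.lab = .hs c → ζ.lab = .hs c.bar → Dom D χ → Dom D ζ →
        s₁.En χ.shape ∧ s₂.En ζ.shape) →
      (∃ y, x = .left y ∧ s₁.En y) ∨ (∃ z, x = .right z ∧ s₂.En z) ∨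
      ∃ y z c, x = .both y z ∧ y.lab = .hs c ∧ z.lab = .hs c.bar ∧ s₁.En y ∧ s₂.En z := by
    rintro χ ζ hχ rfl H₁ H₂ H₃
    obtain ⟨hb, hr, h, e⟩ | ⟨hr, hb, h, e⟩ | ⟨⟨c, e₁, e₂⟩, h₁, h₂, e⟩ := hχ.parB_cases
    · exact .inl ⟨_, e, H₁ hb hr h⟩
    · exact .inr (.inl ⟨_, e, H₂ hr hb h⟩)
    · exact .inr (.inr ⟨_, _, c, e, h₁.lab_shape.trans e₁, h₂.lab_shape.trans e₂,
        H₃ c e₁ e₂ h₁ h₂⟩)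
  have no : ∀ {α : Act B C}, α.IsReceive → ¬ α.IsBroadcast := Act.not_isBroadcast_of_isReceive
  have no' : ∀ {α : Act B C} {c}, α.IsReceive → α ≠ .hs c := by
    rintro _ _ ⟨b, rfl⟩ ⟨⟩
  cases h with
  | proc P Q =>
    obtain ⟨χ, hχ, e, hs⟩ := hx
    cases χ <;> simp [DTerm.src] at hs
    · exact .inl ⟨_, e.symm, _, (dom_parL.1 hχ).1, rfl, hs.1⟩
    · exact .inr (.inl ⟨_, e.symm, _, (dom_parR.1 hχ).1, rfl, hs.2⟩)
    · exact key hχ e (fun _ _ h => ⟨_, h, rfl, hs.1⟩) (fun _ _ h => ⟨_, h, rfl, hs.2⟩)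
        fun _ _ _ h h' => ⟨⟨_, h, rfl, hs.1⟩, ⟨_, h', rfl, hs.2⟩⟩
  | left _ _ =>
    obtain ⟨χ, hχ, e, hc⟩ := hx
    cases hc with
    | right_left _ _ _ hQ => exact .inr (.inl ⟨_, e.symm, _, (dom_parR.1 hχ).1, rfl, hQ⟩)
    -- The left part of the enabled derivation merely receives. That the left component moves is
    -- therefore irrelevant, and the sender on the right sits in an idle component.
    | both_left _ _ hs _ hr =>
      exact key hχ e (fun h => absurd h (no hr)) (fun _ _ h => ⟨_, h, rfl, hs⟩)
        fun _ h => absurd h (no' hr)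
    | parL hc => exact .inl ⟨_, e.symm, _, (dom_parL.1 hχ).1, rfl, hc⟩
    | parB_parL hc hP =>
      exact key hχ e (fun _ _ h => ⟨_, h, rfl, hc⟩) (fun _ _ h => ⟨_, h, rfl, hP.symm⟩)
        fun _ _ _ h h' => ⟨⟨_, h, rfl, hc⟩, ⟨_, h', rfl, hP.symm⟩⟩
  | right _ _ =>
    obtain ⟨χ, hχ, e, hc⟩ := hx
    cases hc with
    | left_right _ _ hP => exact .inl ⟨_, e.symm, _, (dom_parL.1 hχ).1, rfl, hP⟩
    | both_right _ _ hs _ hr =>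
      exact key hχ e (fun _ _ h => ⟨_, h, rfl, hs⟩) (fun _ h => absurd h (no hr))
        fun _ _ h => absurd h (no' hr)
    | parR hc => exact .inr (.inl ⟨_, e.symm, _, (dom_parR.1 hχ).1, rfl, hc⟩)
    | parB_parR hc hP =>
      exact key hχ e (fun _ _ h => ⟨_, h, rfl, hP.symm⟩) (fun _ _ h => ⟨_, h, rfl, hc⟩)
        fun _ _ _ h h' => ⟨⟨_, h, rfl, hP.symm⟩, ⟨_, h', rfl, hc⟩⟩
  | both _ _ _ =>
    obtain ⟨χ, hχ, e, hc⟩ := hx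
    cases hc with
    | parL_parB hc => exact .inl ⟨_, e.symm, _, (dom_parL.1 hχ).1, rfl, hc⟩
    | parR_parB hc => exact .inr (.inl ⟨_, e.symm, _, (dom_parR.1 hχ).1, rfl, hc⟩)
    | parB_receiveR hc _ hr =>
      exact key hχ e (fun _ _ h => ⟨_, h, rfl, hc⟩) (fun _ h => absurd h (no hr))
        fun _ _ h => absurd h (no' hr)
    | parB_receiveL hc _ hr =>
      exact key hχ e (fun h => absurd h (no hr)) (fun _ _ h => ⟨_, h, rfl, hc⟩)
        fun _ h => absurd h (no' hr)
    | parB hc hc' =>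
      exact key hχ e (fun _ _ h => ⟨_, h, rfl, hc⟩) (fun _ _ h => ⟨_, h, rfl, hc'⟩)
        fun _ _ _ h h' => ⟨⟨_, h, rfl, hc⟩, ⟨_, h', rfl, hc'⟩⟩

/-! ### Enabledness passes from components to parallel compositions -/

theorem canSync_of_comp {s₁ s₂ s : Sharp} {b : B} (h : s₁.comp s₂ = some s) :
    CanSync (.bc s₁ b : Act B C) (.bc s₂ b) := .inr ⟨_, _, _, _, h, rfl, rfl⟩

/-- A derivation whose label is not a receive action extends to a parallel composition: the other
component either is idle or receives. -/
theorem Dom.idle_or_receive (hD : ∀ a, (D a).Guarded) {χ : DTerm A B C} (h : Dom D χ)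
    (Q : Proc A B C) : CanIdle D χ.lab Q ∨ χ.lab.IsBroadcast ∧ ∃ ς, IsDer D ς ∧ ς.src = Q ∧
      ς.lab.IsReceive ∧ CanSync χ.lab ς.lab ∧ CanSync ς.lab χ.lab := by
  by_cases hQ : CanIdle D χ.lab Q
  · exact .inl hQ
  · simp only [CanIdle, not_forall, not_not] at hQ
    obtain ⟨s, b, e, hb⟩ := hQ
    obtain ⟨Q', ς, hς⟩ := (receives_iff hD Q b).1 hb
    obtain ⟨hs, hl, -⟩ := hς.eq
    cases s with
    | query => exact absurd ⟨b, e⟩ h.2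
    | bang =>
      refine .inr ⟨⟨b, e⟩, ς, ⟨_, _, _, hς⟩, hs, ⟨b, hl⟩, ?_, ?_⟩ <;> rw [e, hl]
      exacts [canSync_of_comp rfl, canSync_of_comp rfl]

/-- The derivation of `y` is combined with an idle right component or, when `y` broadcasts and the
right source listens, with an arbitrary reception. The concurrency clauses require nothing of a
receiver beyond its source, so moves of the right component cannot disable `y`. Guardedness supplies
an actual derivation of the reception. -/
theorem UPar.en_left (hD : ∀ a, (D a).Guarded) {s s₁ s₂ : UState D} (h : UPar D s s₁ s₂)
    {y : Shape A B C} (hy : s₁.En y) : s.En (.left y) := by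
  have dom : ∀ {χ ς : DTerm A B C}, Dom D χ → χ.lab.IsBroadcast → IsDer D ς →
      CanSync χ.lab ς.lab → Dom D (.parB χ ς) ∧ (DTerm.parB χ ς).shape = .left χ.shape := by
    intro χ ς h hb hς hc
    refine ⟨⟨isDer_parB.2 ⟨h.1, hς, hc⟩, ?_⟩, by simp [DTerm.shape, hb]⟩
    obtain ⟨b, hb⟩ := hb
    rw [hb] at hc
    obtain ⟨c, e, -⟩ | ⟨s₁, s₂, s, b', hs, e₁, e₂⟩ := hc
    · cases e
    · cases e₁
      cases s₂ <;> simp [DTerm.lab, hb, e₂, Act.sync, Sharp.comp, Act.IsReceive]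
  cases h with
  | proc P Q =>
    obtain ⟨χ, hχ, rfl, rfl⟩ := hy
    obtain hQ | ⟨hb, ς, hς, rfl, hr, hc, -⟩ := hχ.idle_or_receive hD Q
    · exact ⟨.parL χ Q, dom_parL.2 ⟨hχ, hQ⟩, rfl, rfl⟩
    · obtain ⟨h₁, h₂⟩ := dom hχ hb hς hc
      exact ⟨_, h₁, h₂, rfl⟩
  | @left ζ Q _ h =>
    obtain ⟨χ, hχ, rfl, hζ⟩ := hy
    obtain hQ | ⟨hb, ς, hς, rfl, hr, hc, -⟩ := hχ.idle_or_receive hD Q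
    · exact ⟨.parL χ Q, dom_parL.2 ⟨hχ, hQ⟩, rfl, .parL hζ (isDer_parL.2 ⟨hχ.1, hQ⟩) h⟩
    · obtain ⟨h₁, h₂⟩ := dom hχ hb hς hc
      exact ⟨_, h₁, h₂, .parB_parL hζ rfl h₁.1 h⟩
  | @right ζ P _ h =>
    obtain ⟨χ, hχ, rfl, hs⟩ := hy
    obtain hQ | ⟨hb, ς, hς, hς', hr, hc, -⟩ := hχ.idle_or_receive hD ζ.src
    · exact ⟨.parL χ ζ.src, dom_parL.2 ⟨hχ, hQ⟩, rfl,
        .left_right (isDer_parL.2 ⟨hχ.1, hQ⟩) h hs rfl⟩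
    · obtain ⟨h₁, h₂⟩ := dom hχ hb hς hc
      exact ⟨_, h₁, h₂, .both_right h₁.1 h hs hς' hr⟩
  | @both ζ ξ _ _ h =>
    obtain ⟨χ, hχ, rfl, hζ⟩ := hy
    obtain hQ | ⟨hb, ς, hς, hς', hr, hc, -⟩ := hχ.idle_or_receive hD ξ.src
    · exact ⟨.parL χ ξ.src, dom_parL.2 ⟨hχ, hQ⟩, rfl,
        .parL_parB hζ rfl (isDer_parL.2 ⟨hχ.1, hQ⟩) h⟩
    · obtain ⟨h₁, h₂⟩ := dom hχ hb hς hc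
      exact ⟨_, h₁, h₂, .parB_receiveR hζ hς' hr h₁.1 h⟩

theorem UPar.en_right (hD : ∀ a, (D a).Guarded) {s s₁ s₂ : UState D} (h : UPar D s s₁ s₂)
    {y : Shape A B C} (hy : s₂.En y) : s.En (.right y) := by
  -- Unlike on the left, the label of the receiver is needed to compute the shape, since
  -- `DTerm.shape` tests the left side for a broadcast first.
  have dom : ∀ {χ ς : DTerm A B C}, Dom D χ → χ.lab.IsBroadcast → ς.lab.IsReceive → IsDer D ς →
      CanSync ς.lab χ.lab → Dom D (.parB ς χ) ∧ (DTerm.parB ς χ).shape = .right χ.shape := by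
    intro χ ς h hb hr hς hc
    refine ⟨⟨isDer_parB.2 ⟨hς, h.1, hc⟩, ?_⟩,
      by simp [DTerm.shape, hb, Act.not_isBroadcast_of_isReceive hr]⟩
    obtain ⟨b, hb⟩ := hb
    rw [hb] at hc
    obtain ⟨c, -, e⟩ | ⟨s₁, s₂, s, b', hs, e₁, e₂⟩ := hc
    · cases e
    · cases e₂
      cases s₁ <;> simp [DTerm.lab, hb, e₁, Act.sync, Sharp.comp, Act.IsReceive]
  cases h with
  | proc P Q =>
    obtain ⟨χ, hχ, rfl, rfl⟩ := hy
    obtain hQ | ⟨hb, ς, hς, rfl, hr, -, hc⟩ := hχ.idle_or_receive hD P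
    · exact ⟨.parR P χ, dom_parR.2 ⟨hχ, hQ⟩, rfl, rfl⟩
    · obtain ⟨h₁, h₂⟩ := dom hχ hb hr hς hc
      exact ⟨_, h₁, h₂, rfl⟩
  | @right ζ P _ h =>
    obtain ⟨χ, hχ, rfl, hζ⟩ := hy
    obtain hQ | ⟨hb, ς, hς, rfl, hr, -, hc⟩ := hχ.idle_or_receive hD P
    · exact ⟨.parR P χ, dom_parR.2 ⟨hχ, hQ⟩, rfl, .parR hζ (isDer_parR.2 ⟨hχ.1, hQ⟩) h⟩
    · obtain ⟨h₁, h₂⟩ := dom hχ hb hr hς hc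
      exact ⟨_, h₁, h₂, .parB_parR hζ rfl h₁.1 h⟩
  | @left ζ Q _ h =>
    obtain ⟨χ, hχ, rfl, hs⟩ := hy
    obtain hQ | ⟨hb, ς, hς, hς', hr, -, hc⟩ := hχ.idle_or_receive hD ζ.src
    · exact ⟨.parR ζ.src χ, dom_parR.2 ⟨hχ, hQ⟩, rfl,
        .right_left (isDer_parR.2 ⟨hχ.1, hQ⟩) h rfl hs⟩
    · obtain ⟨h₁, h₂⟩ := dom hχ hb hr hς hc
      exact ⟨_, h₁, h₂, .both_left h₁.1 h hs hς' hr⟩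
  | @both ξ ζ _ _ h =>
    obtain ⟨χ, hχ, rfl, hζ⟩ := hy
    obtain hQ | ⟨hb, ς, hς, hς', hr, -, hc⟩ := hχ.idle_or_receive hD ξ.src
    · exact ⟨.parR ξ.src χ, dom_parR.2 ⟨hχ, hQ⟩, rfl,
        .parR_parB hζ rfl (isDer_parR.2 ⟨hχ.1, hQ⟩) h⟩
    · obtain ⟨h₁, h₂⟩ := dom hχ hb hr hς hc
      exact ⟨_, h₁, h₂, .parB_receiveL hζ hς' hr h₁.1 h⟩

theorem UPar.en_both {s s₁ s₂ : UState D} (h : UPar D s s₁ s₂) {y z : Shape A B C} {c : HS C}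
    (hy : y.lab = .hs c) (hz : z.lab = .hs c.bar) (h₁ : s₁.En y) (h₂ : s₂.En z) :
    s.En (.both y z) := by
  have dom : ∀ {χ ζ : DTerm A B C}, Dom D χ → Dom D ζ → χ.shape = y → ζ.shape = z →
      Dom D (.parB χ ζ) ∧ (DTerm.parB χ ζ).shape = .both y z := by
    rintro χ ζ hχ hζ rfl rfl
    rw [hχ.lab_shape] at hy
    rw [hζ.lab_shape] at hz
    exact ⟨dom_parB_of_hs hχ.1 hζ.1 hy hz, by simp [DTerm.shape, hy, hz, Act.IsBroadcast]⟩
  cases h with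
  | proc P Q =>
    obtain ⟨χ, hχ, eχ, rfl⟩ := h₁
    obtain ⟨ζ, hζ, eζ, rfl⟩ := h₂
    obtain ⟨h, e⟩ := dom hχ hζ eχ eζ
    exact ⟨_, h, e, rfl⟩
  | left _ h' =>
    obtain ⟨χ, hχ, eχ, hc⟩ := h₁
    obtain ⟨ζ, hζ, eζ, rfl⟩ := h₂
    obtain ⟨h, e⟩ := dom hχ hζ eχ eζ
    exact ⟨_, h, e, .parB_parL hc rfl h.1 h'⟩
  | right _ h' =>
    obtain ⟨χ, hχ, eχ, rfl⟩ := h₁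
    obtain ⟨ζ, hζ, eζ, hc⟩ := h₂
    obtain ⟨h, e⟩ := dom hχ hζ eχ eζ
    exact ⟨_, h, e, .parB_parR hc rfl h.1 h'⟩
  | both _ _ h' =>
    obtain ⟨χ, hχ, eχ, hc⟩ := h₁
    obtain ⟨ζ, hζ, eζ, hc'⟩ := h₂
    obtain ⟨h, e⟩ := dom hχ hζ eχ eζ
    exact ⟨_, h, e, .parB hc hc' h.1 h'⟩

end Enabled

end Concurrency

/-! ### Constructions on paths -/

section Paths

variable {σ : Type u} {τ : Type v} {R : σ → σ → Prop} {E : σ → Prop} {R' : τ → τ → Prop}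
  {E' : τ → Prop}

theorem Path.isSome_of_le (π : Path R E) {m n : ℕ} (h : m ≤ n) (hn : (π.st n).isSome) :
    (π.st m).isSome := by
  induction n, h using Nat.le_induction with
  | base => exact hn
  | succ n _ ih =>
    refine ih (Option.isSome_iff_ne_none.2 fun h => ?_)
    simp [π.closed n h] at hn

/-- A simulation `Q` maps a path to a path that is pointwise related to it. -/
theorem Path.exists_rel (Q : σ → τ → Prop) (π : Path R E)
    (h₀ : ∀ s, π.st 0 = some s → ∃ t, Q s t)
    (hQ : ∀ s s' t, R s s' → Q s t → ∃ t', Q s' t')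
    (hR : ∀ s s' t t', R s s' → Q s t → Q s' t' → R' t t') (hE : ∀ s t, E s → Q s t → E' t) :
    ∃ π' : Path R' E', ∀ n, Option.Rel Q (π.st n) (π'.st n) := by
  have ex : ∀ n s, π.st n = some s → ∃ t, Q s t := by
    intro n
    induction n with
    | zero => exact h₀
    | succ n ih =>
      intro s hs
      obtain ⟨s', hs'⟩ := Option.isSome_iff_exists.1
        (π.isSome_of_le n.le_succ (Option.isSome_iff_exists.2 ⟨s, hs⟩))
      obtain ⟨t, ht⟩ := ih s' hs'
      exact hQ _ _ _ (π.step n s' s hs' hs) ht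
  have ex' : ∀ n, ∃ o : Option τ, Option.Rel Q (π.st n) o := by
    intro n
    cases h : π.st n with
    | none => exact ⟨none, .none⟩
    | some s =>
      obtain ⟨t, ht⟩ := ex n s h
      exact ⟨some t, .some ht⟩
  choose p hp using ex'
  have some_of : ∀ n t, p n = some t → ∃ s, π.st n = some s ∧ Q s t := by
    intro n t ht
    have h := hp n
    rw [ht] at h
    generalize π.st n = o at h
    cases h with | some h => exact ⟨_, rfl, h⟩
  have none_of : ∀ n, p n = none ↔ π.st n = none := by
    intro n
    have h := hp n
    generalize π.st n = o at h
    generalize p n = o' at h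
    cases h <;> simp
  refine ⟨⟨p, ?_, ?_, ?_, ?_⟩, hp⟩
  · rw [Option.isSome_iff_ne_none, ne_eq, none_of, ← ne_eq, ← Option.isSome_iff_ne_none]
    exact π.nonempty
  · intro n h
    rw [none_of] at h ⊢
    exact π.closed n h
  · intro n t t' h h'
    obtain ⟨s, hs, hQ⟩ := some_of _ _ h
    obtain ⟨s', hs', hQ'⟩ := some_of _ _ h'
    exact hR _ _ _ _ (π.step n s s' hs hs') hQ hQ'
  · intro n t h h'
    obtain ⟨s, hs, hQ⟩ := some_of _ _ h
    exact hE _ _ (π.last n s hs ((none_of _).1 h')) hQ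

theorem le_of_step_le {i : ℕ → ℕ} (h : ∀ m, i (m + 1) = i m ∨ i (m + 1) = i m + 1) : Monotone i :=
  monotone_nat_of_le_succ fun m => by have := h m; omega

/-- A sequence of states, consecutive ones being either equal or related by a step, becomes a path
when repetitions are deleted. -/
theorem Path.exists_destutter (d : ℕ → Prop) (l : ℕ → τ) (d₀ : d 0) (hd : ∀ m, d (m + 1) → d m)
    (hl : ∀ m, d (m + 1) → (l m = l (m + 1) ∧ E' (l m)) ∨ R' (l m) (l (m + 1)))
    (hE : ∀ m, d m → ¬ d (m + 1) → E' (l m)) :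
    ∃ (π : Path R' E') (i : ℕ → ℕ), i 0 = 0 ∧ (∀ m, i (m + 1) = i m ∨ i (m + 1) = i m + 1) ∧
      (∀ m, d m → π.st (i m) = some (l m)) ∧ ∀ k, (π.st k).isSome → ∃ m, d m ∧ i m = k := by
  classical
  -- `p` marks the positions at which the new path advances, and `i` counts them. A repetition is
  -- skipped only in an end state, because the new path may stop at a state that is repeated
  -- forever.
  let p : ℕ → Prop := fun m => d (m + 1) ∧ ¬ (l m = l (m + 1) ∧ E' (l m))
  let i : ℕ → ℕ := Nat.count p
  have hi : ∀ m, i (m + 1) = i m + if p m then 1 else 0 := Nat.count_succ p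
  have hi' : ∀ m, i (m + 1) = i m ∨ i (m + 1) = i m + 1 := by
    intro m
    rw [hi]
    split <;> simp
  have mono : Monotone i := le_of_step_le hi'
  have hdle : ∀ {m n}, m ≤ n → d n → d m := by
    intro m n h
    induction n, h using Nat.le_induction with
    | base => exact id
    | succ n _ ih => exact fun h => ih (hd n h)
  have const : ∀ {m n}, m ≤ n → d n → i m = i n → l m = l n := by
    intro m n h
    induction n, h using Nat.le_induction with
    | base => exact fun _ _ => rfl
    | succ n h ih =>
      intro hn e
      have h₁ := mono h
      have h₂ := hi n
      by_cases hp : p n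
      · simp only [hp, if_true] at h₂
        omega
      · simp only [hp, if_false] at h₂
        have : l n = l (n + 1) := by
          by_contra hne
          exact hp ⟨hn, fun h => hne h.1⟩
        rw [ih (hd n hn) (by omega), this]
  have const' : ∀ {m n}, d m → d n → i m = i n → l m = l n := by
    intro m n hm hn e
    rcases le_total m n with h | h
    · exact const h hn e
    · exact (const h hm e.symm).symm
  -- By `const'` the state does not depend on which position with index `k` is chosen.
  let st : ℕ → Option τ := fun k =>
    if h : ∃ m, d m ∧ i m = k then some (l h.choose) else none
  have st_i : ∀ m, d m → st (i m) = some (l m) := by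
    intro m hm
    have h : ∃ n, d n ∧ i n = i m := ⟨m, hm, rfl⟩
    simp only [st, dif_pos h]
    exact congrArg some (const' h.choose_spec.1 hm h.choose_spec.2)
  have ex_st : ∀ {k}, (st k).isSome → ∃ m, d m ∧ i m = k := by
    intro k hk
    by_contra h
    simp [st, dif_neg h] at hk
  have st_none : ∀ {k}, st k = none → ∀ m, d m → i m ≠ k := by
    rintro k hk m hm rfl
    rw [st_i m hm] at hk
    cases hk
  have ex_succ : ∀ m n, d n → i m < i n → ∃ m', d (m' + 1) ∧ i m' = i m ∧ i (m' + 1) = i m + 1 := by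
    intro m n hn
    induction n with
    | zero =>
      intro h
      have := mono (Nat.zero_le m)
      omega
    | succ n ih =>
      intro h
      by_cases h' : i m < i n
      · exact ih (hd n hn) h'
      · have := hi' n
        have hmn : i n ≤ i m := not_lt.1 h'
        exact ⟨n, hn, by omega, by omega⟩
  refine ⟨⟨st, ?_, ?_, ?_, ?_⟩, i, Nat.count_zero p, hi', st_i, fun k => ex_st⟩
  · rw [← Nat.count_zero p]
    change (st (i 0)).isSome
    rw [st_i 0 d₀]
    rfl
  · intro k hk
    by_contra h
    obtain ⟨n, hn, e⟩ := ex_st (Option.isSome_iff_ne_none.2 h)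
    -- The index starts at 0 and grows by at most 1, so it cannot jump over a missing value `k`.
    have key : ∀ n, d n → i n ≤ k := by
      intro n
      induction n with
      | zero => intro _; simp [i]
      | succ n ih =>
        intro hn
        have h₁ := ih (hd n hn)
        have h₂ := st_none hk n (hd n hn)
        have := hi' n
        omega
    have := key n hn
    omega
  · intro k s t hs ht
    obtain ⟨m, hm, rfl⟩ := ex_st (Option.isSome_iff_exists.2 ⟨s, hs⟩)
    obtain ⟨n, hn, e⟩ := ex_st (Option.isSome_iff_exists.2 ⟨t, ht⟩)
    obtain ⟨m', hm', e₁, e₂⟩ := ex_succ m n hn (by omega)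
    rw [← e₁, st_i m' (hd m' hm')] at hs
    rw [← e₂, st_i _ hm'] at ht
    cases hs
    cases ht
    refine (hl m' hm').resolve_left fun h => ?_
    have := hi m'
    rw [if_neg (fun hp : p m' => hp.2 h)] at this
    omega
  · intro k s hs hk
    obtain ⟨m, hm, rfl⟩ := ex_st (Option.isSome_iff_exists.2 ⟨s, hs⟩)
    rw [st_i m hm] at hs
    cases hs
    by_cases hm' : d (m + 1)
    -- The index does not advance at `m` although the sequence goes on, so position `m` is a
    -- repetition, in an end state by the choice of `p`.
    · have h₁ := st_none hk (m + 1) hm'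
      by_contra h
      have := hi m
      rw [if_pos (⟨hm', fun h' => h h'.2⟩ : p m)] at this
      exact h₁ this
    · exact hE m hm hm'

end Paths

section Decomposition

variable {A : Type u} {B : Type v} {C : Type w} {D : A → Proc A B C}

/-! ### Eventually always enabled shapes -/

/-- From some state of the path onwards, the shape `x` is enabled. -/
def UPath.EvEn (π : UPath D) (x : Shape A B C) : Prop :=
  ∃ n, (π.st n).isSome ∧ ∀ m, n ≤ m → ∀ s, π.st m = some s → s.En x

/-- The justice formula says that a transition is not enabled forever, because it is not enabled
while it occurs. -/
theorem sat_justice_iff (π : UPath D) (χ₀ : {χ : DTerm A B C // Dom D χ}) :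
    Path.Sat UState.Holds (justice (Quotient.mk (absSetoid D) χ₀)) π ↔
      ¬ π.EvEn χ₀.1.shape := by
  have fg : Path.Sat UState.Holds
      (.F (.G (.atom (.en (Quotient.mk (absSetoid D) χ₀))))) π ↔ π.EvEn χ₀.1.shape := by
    simp only [Path.Sat, Path.suffix, UPath.EvEn, UState.holds_en_iff, add_zero]
    constructor
    · rintro ⟨n, hn, h⟩
      refine ⟨n, hn, fun m hm s hs => ?_⟩
      obtain ⟨k, rfl⟩ := Nat.exists_eq_add_of_le hm
      obtain ⟨s', hs', h'⟩ := h k (by simp [hs])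
      rw [hs] at hs'
      cases hs'
      exact h'
    · rintro ⟨n, hn, h⟩
      refine ⟨n, hn, fun m hm => ?_⟩
      obtain ⟨s, hs⟩ := Option.isSome_iff_exists.1 hm
      exact ⟨s, hs, h _ (Nat.le_add_right _ _) s hs⟩
  constructor
  · intro h hx
    obtain ⟨n, hn, hen⟩ := hx
    -- An occurrence at a position where the shape is already permanently enabled, contrary to
    -- `UState.not_en_shape`.
    obtain ⟨m, hm, s, hs, ho⟩ := h (fg.2 ⟨n, hn, hen⟩) n hn
    cases s with
    | proc P => exact ho
    | der ζ hζ =>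
      obtain ⟨hd, e⟩ := AbsTrans.rep_iff.1 ho
      have := hen (n + m) (Nat.le_add_right _ _) _ hs
      rw [← e] at this
      exact UState.not_en_shape hd this
  · exact fun h hx => absurd (fg.1 hx) h

/-! ### Projection to `S` and lifting to `U` -/

theorem UState.eq_proc_of_hat {s : UState D} {P : Proc A B C} (h : s.hat = .proc P) :
    s = .proc P := by
  cases s with
  | proc Q => cases h; rfl
  | der χ hχ => cases h

theorem UState.eq_der_of_hat {s : UState D} {P Q : Proc A B C} {α : Act B C} {hs : Step D P α Q}
    (h : s.hat = .trans P α Q hs) :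
    ∃ χ hχ, s = .der χ hχ ∧ χ.src = P ∧ χ.lab = α ∧ χ.tgt = Q := by
  cases s with
  | proc Q => cases h
  | der χ hχ => cases h; exact ⟨χ, hχ, rfl, rfl, rfl, rfl⟩

theorem UState.hat_surjective : Function.Surjective (UState.hat : UState D → SState D) := by
  rintro (P | ⟨P, α, Q, χ, h⟩)
  · exact ⟨.proc P, rfl⟩
  · obtain ⟨rfl, rfl, rfl⟩ := h.eq
    exact ⟨.der χ ⟨_, _, _, h⟩, rfl⟩

theorem UPath.hat_st (π : UPath D) (n : ℕ) : π.hat.st n = (π.st n).map UState.hat := rfl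

/-- Steps of `U` depend only on source and target, which the projection retains. Derivations may
therefore be chosen state by state along a path in `S`. -/
theorem UStep.of_hat {s t : UState D} (h : SStep D s.hat t.hat) : UStep D s t := by
  cases s with
  | proc P =>
    cases t with
    | proc Q => cases h
    | der χ hχ =>
      generalize ht : (UState.der χ hχ).hat = t' at h
      generalize hs : (UState.proc P : UState D).hat = s' at h
      cases h with
      | start h => cases ht; cases hs; exact .start hχ
      | finish h => cases hs
  | der χ hχ =>
    cases t with
    | proc Q =>
      generalize ht : (UState.proc Q : UState D).hat = t' at h
      generalize hs : (UState.der χ hχ).hat = s' at h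
      cases h with
      | start h => cases ht
      | finish h => cases ht; cases hs; exact .finish hχ
    | der ζ hζ => cases h

/-- A sequence of states of `U` whose projection is a path is a path. -/
def UPath.ofLift (ρ : SPath D) (g : ℕ → Option (UState D))
    (h : ∀ n, (g n).map UState.hat = ρ.st n) : UPath D where
  st := g
  nonempty := by simpa [← h] using ρ.nonempty
  closed n hn := by simpa [← h, hn] using ρ.closed n
  step n s t hs ht := .of_hat (ρ.step n _ _ (by simp [← h, hs]) (by simp [← h, ht]))
  last n s hs ht := by
    obtain ⟨P, hP⟩ := ρ.last n s.hat (by simp [← h, hs]) (by simp [← h, ht])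
    exact ⟨P, UState.eq_proc_of_hat hP⟩

theorem UPath.hat_ofLift (ρ : SPath D) (g : ℕ → Option (UState D))
    (h : ∀ n, (g n).map UState.hat = ρ.st n) : (UPath.ofLift ρ g h).hat = ρ :=
  Path.ext (funext h)

theorem UPar.hat {s s₁ s₂ : UState D} (h : UPar D s s₁ s₂) :
    ParState D s.hat s₁.hat s₂.hat := by
  cases h with
  | proc P Q => exact .proc P Q
  | left h₁ h => exact .left h₁.derives h.derives
  | both h₁ h₂ h => exact .both h₁.derives h₂.derives h.derives
  | right h₂ h => exact .right h₂.derives h.derives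

theorem URes.hat {c : HS C} {s s' : UState D} (h : URes D c s s') :
    ResState D c s.hat s'.hat := by
  cases h with
  | proc P => exact .proc P
  | der h₁ h => exact .trans ⟨_, h₁.derives⟩ ⟨_, h.derives⟩

theorem URel.hat {f : Relabelling B C} {s s' : UState D} (h : URel D f s s') :
    RelState D f s.hat s'.hat := by
  cases h with
  | proc P => exact .proc P
  | der h₁ h => exact .trans ⟨_, h₁.derives⟩ ⟨_, h.derives⟩

/-- Whether premises can be composed depends only on their labels and on the source of the idle
side. So any derivations of the component transitions can be composed, not only those witnessing
`ParState`; this allows the components to be lifted independently. -/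
theorem ParState.exists_lift {s : SState D} {s₁ s₂ : UState D}
    (h : ParState D s s₁.hat s₂.hat) : ∃ t : UState D, t.hat = s ∧ UPar D t s₁ s₂ := by
  generalize e₁ : s₁.hat = t₁ at h
  generalize e₂ : s₂.hat = t₂ at h
  cases h with
  | proc P Q =>
    cases UState.eq_proc_of_hat e₁
    cases UState.eq_proc_of_hat e₂
    exact ⟨_, rfl, .proc P Q⟩
  | left h₁ h =>
    obtain ⟨χ, hχ, rfl, rfl, rfl, rfl⟩ := UState.eq_der_of_hat e₁
    cases UState.eq_proc_of_hat e₂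
    have h' := (isDer_parL.1 ⟨_, _, _, h⟩).2
    rw [h₁.eq.2.1] at h'
    exact ⟨.der _ (isDer_parL.2 ⟨hχ, h'⟩), rfl, .left hχ _⟩
  | both h₁ h₂ h =>
    obtain ⟨χ, hχ, rfl, rfl, rfl, rfl⟩ := UState.eq_der_of_hat e₁
    obtain ⟨ζ, hζ, rfl, rfl, rfl, rfl⟩ := UState.eq_der_of_hat e₂
    have h' := (isDer_parB.1 ⟨_, _, _, h⟩).2.2
    have e := h.eq.2.1
    simp only [DTerm.lab] at e
    rw [h₁.eq.2.1, h₂.eq.2.1] at h' e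
    subst e
    exact ⟨.der _ (isDer_parB.2 ⟨hχ, hζ, h'⟩), rfl, .both hχ hζ _⟩
  | right h₂ h =>
    obtain ⟨χ, hχ, rfl, rfl, rfl, rfl⟩ := UState.eq_der_of_hat e₂
    cases UState.eq_proc_of_hat e₁
    have h' := (isDer_parR.1 ⟨_, _, _, h⟩).2
    rw [h₂.eq.2.1] at h'
    exact ⟨.der _ (isDer_parR.2 ⟨hχ, h'⟩), rfl, .right hχ _⟩

theorem ResState.exists_lift {c : HS C} {s : SState D} {s' : UState D}
    (h : ResState D c s s'.hat) : ∃ t : UState D, t.hat = s ∧ URes D c t s' := by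
  generalize e : s'.hat = t' at h
  cases h with
  | proc P =>
    cases UState.eq_proc_of_hat e
    exact ⟨_, rfl, .proc P⟩
  | trans h₁ h =>
    obtain ⟨χ, hχ, rfl, rfl, rfl, rfl⟩ := UState.eq_der_of_hat e
    obtain ⟨ζ, hζ⟩ := h
    cases hζ with
    | res _ h₁ h₂ _ => exact ⟨.der _ (isDer_res.2 ⟨hχ, h₁, h₂⟩), rfl, .der hχ _⟩

theorem RelState.exists_lift {f : Relabelling B C} {s : SState D} {s' : UState D}
    (h : RelState D f s s'.hat) : ∃ t : UState D, t.hat = s ∧ URel D f t s' := by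
  generalize e : s'.hat = t' at h
  cases h with
  | proc P =>
    cases UState.eq_proc_of_hat e
    exact ⟨_, rfl, .proc P⟩
  | trans h₁ h =>
    obtain ⟨χ, hχ, rfl, rfl, rfl, rfl⟩ := UState.eq_der_of_hat e
    exact ⟨.der _ (isDer_rel.2 hχ), rfl, .der hχ _⟩

/-! ### Decomposition of paths in `U` -/

/-- The path `π` of a parallel composition in `U` is decomposed into `π₁` and `π₂`; its `m`-th
state consists of the `i m`-th state of `π₁` and the `j m`-th state of `π₂`. -/
structure UParDecomp (π π₁ π₂ : UPath D) (i j : ℕ → ℕ) : Prop where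
  i_zero : i 0 = 0
  j_zero : j 0 = 0
  i_succ : ∀ m, i (m + 1) = i m ∨ i (m + 1) = i m + 1
  j_succ : ∀ m, j (m + 1) = j m ∨ j (m + 1) = j m + 1
  st : ∀ m s, π.st m = some s →
    ∃ s₁ s₂, π₁.st (i m) = some s₁ ∧ π₂.st (j m) = some s₂ ∧ UPar D s s₁ s₂
  i_surj : ∀ k, (π₁.st k).isSome → ∃ m, (π.st m).isSome ∧ i m = k
  j_surj : ∀ k, (π₂.st k).isSome → ∃ m, (π.st m).isSome ∧ j m = k

namespace UParDecomp

variable {π π₁ π₂ : UPath D} {i j : ℕ → ℕ}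

theorem hat (h : UParDecomp π π₁ π₂ i j) : ParDecomp π.hat π₁.hat π₂.hat := by
  refine ⟨i, j, h.i_zero, h.j_zero, h.i_succ, h.j_succ, ?_, ?_, ?_⟩
  · intro m s hs
    rw [UPath.hat_st, Option.map_eq_some_iff] at hs
    obtain ⟨s, hs, rfl⟩ := hs
    obtain ⟨s₁, s₂, h₁, h₂, hp⟩ := h.st m s hs
    exact ⟨_, _, by simp [UPath.hat_st, h₁], by simp [UPath.hat_st, h₂], hp.hat⟩
  · simpa [UPath.hat_st] using h.i_surj
  · simpa [UPath.hat_st] using h.j_surj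

/-- Turns "from `n` on" in the composition into "from `i n` on" in a component: if the position
found for `k` precedes `n`, monotonicity gives `k = i n`, and `n` itself serves. -/
theorem exists_index {i : ℕ → ℕ} {p q : ℕ → Prop}
    (mono : Monotone i) (surj : ∀ k, q k → ∃ m, p m ∧ i m = k) {n k : ℕ} (hn : p n)
    (hk : i n ≤ k) (hq : q k) : ∃ m, n ≤ m ∧ p m ∧ i m = k := by
  obtain ⟨m, hm, rfl⟩ := surj k hq
  rcases le_total n m with h | h
  · exact ⟨m, h, hm, rfl⟩
  · exact ⟨n, le_rfl, hn, le_antisymm hk (mono h)⟩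

theorem evEn (h : UParDecomp π π₁ π₂ i j) {x : Shape A B C} (hx : π.EvEn x) :
    (∃ y, x = .left y ∧ π₁.EvEn y) ∨ (∃ z, x = .right z ∧ π₂.EvEn z) ∨
      ∃ y z c, x = .both y z ∧ y.lab = .hs c ∧ z.lab = .hs c.bar ∧ π₁.EvEn y ∧ π₂.EvEn z := by
  obtain ⟨n, hn, hen⟩ := hx
  have key₁ : ∀ y, (∀ m, n ≤ m → ∀ s s₁ s₂, π.st m = some s → UPar D s s₁ s₂ → s₁.En y) →
      π₁.EvEn y := by
    intro y hy
    obtain ⟨s, hs⟩ := Option.isSome_iff_exists.1 hn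
    obtain ⟨s₁, s₂, h₁, h₂, hp⟩ := h.st n s hs
    refine ⟨i n, by simp [h₁], fun k hk t ht => ?_⟩
    obtain ⟨m, hm, hm', rfl⟩ := exists_index (le_of_step_le h.i_succ) h.i_surj hn hk
      (by simp [ht])
    obtain ⟨s, hs⟩ := Option.isSome_iff_exists.1 hm'
    obtain ⟨s₁, s₂, h₁, h₂, hp⟩ := h.st m s hs
    rw [h₁] at ht
    cases ht
    exact hy m hm s _ s₂ hs hp
  have key₂ : ∀ y, (∀ m, n ≤ m → ∀ s s₁ s₂, π.st m = some s → UPar D s s₁ s₂ → s₂.En y) →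
      π₂.EvEn y := by
    intro y hy
    obtain ⟨s, hs⟩ := Option.isSome_iff_exists.1 hn
    obtain ⟨s₁, s₂, h₁, h₂, hp⟩ := h.st n s hs
    refine ⟨j n, by simp [h₂], fun k hk t ht => ?_⟩
    obtain ⟨m, hm, hm', rfl⟩ := exists_index (le_of_step_le h.j_succ) h.j_surj hn hk
      (by simp [ht])
    obtain ⟨s, hs⟩ := Option.isSome_iff_exists.1 hm'
    obtain ⟨s₁, s₂, h₁, h₂, hp⟩ := h.st m s hs
    rw [h₂] at ht
    cases ht
    exact hy m hm s s₁ _ hs hp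
  obtain ⟨s, hs⟩ := Option.isSome_iff_exists.1 hn
  obtain ⟨s₁, s₂, h₁, h₂, hp⟩ := h.st n s hs
  -- The root of `x` selects the same alternative at all later positions, so the same component
  -- shapes remain enabled.
  obtain ⟨y, rfl, -⟩ | ⟨z, rfl, -⟩ | ⟨y, z, c, rfl, hy, hz, -⟩ := hp.en (hen n le_rfl s hs)
  · refine .inl ⟨y, rfl, key₁ y fun m hm s s₁ s₂ hs hp => ?_⟩
    obtain ⟨y', e, hy⟩ | ⟨z', e, -⟩ | ⟨y', z', _, e, -⟩ := hp.en (hen m hm s hs) <;> cases e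
    exact hy
  · refine .inr (.inl ⟨z, rfl, key₂ z fun m hm s s₁ s₂ hs hp => ?_⟩)
    obtain ⟨y', e, -⟩ | ⟨z', e, hz⟩ | ⟨y', z', _, e, -⟩ := hp.en (hen m hm s hs) <;> cases e
    exact hz
  · refine .inr (.inr ⟨y, z, c, rfl, hy, hz, key₁ y fun m hm s s₁ s₂ hs hp => ?_,
      key₂ z fun m hm s s₁ s₂ hs hp => ?_⟩)
    all_goals
      obtain ⟨y', e, -⟩ | ⟨z', e, -⟩ | ⟨y', z', _, e, -, -, hy, hz⟩ := hp.en (hen m hm s hs) <;>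
        cases e
    · exact hy
    · exact hz

theorem evEn_left (hD : ∀ a, (D a).Guarded) (h : UParDecomp π π₁ π₂ i j) {y : Shape A B C}
    (hy : π₁.EvEn y) : π.EvEn (.left y) := by
  obtain ⟨k, hk, hen⟩ := hy
  obtain ⟨n, hn, rfl⟩ := h.i_surj k hk
  refine ⟨n, hn, fun m hm s hs => ?_⟩
  obtain ⟨s₁, s₂, h₁, h₂, hp⟩ := h.st m s hs
  exact hp.en_left hD (hen _ (le_of_step_le h.i_succ hm) _ h₁)

theorem evEn_right (hD : ∀ a, (D a).Guarded) (h : UParDecomp π π₁ π₂ i j) {y : Shape A B C}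
    (hy : π₂.EvEn y) : π.EvEn (.right y) := by
  obtain ⟨k, hk, hen⟩ := hy
  obtain ⟨n, hn, rfl⟩ := h.j_surj k hk
  refine ⟨n, hn, fun m hm s hs => ?_⟩
  obtain ⟨s₁, s₂, h₁, h₂, hp⟩ := h.st m s hs
  exact hp.en_right hD (hen _ (le_of_step_le h.j_succ hm) _ h₂)

theorem evEn_both (h : UParDecomp π π₁ π₂ i j) {y z : Shape A B C} {c : HS C}
    (hyc : y.lab = .hs c) (hzc : z.lab = .hs c.bar) (hy : π₁.EvEn y) (hz : π₂.EvEn z) :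
    π.EvEn (.both y z) := by
  obtain ⟨k, hk, hen⟩ := hy
  obtain ⟨k', hk', hen'⟩ := hz
  obtain ⟨n, hn, rfl⟩ := h.i_surj k hk
  obtain ⟨n', hn', rfl⟩ := h.j_surj k' hk'
  refine ⟨max n n', ?_, fun m hm s hs => ?_⟩
  · rcases max_choice n n' with e | e <;> rw [e] <;> assumption
  · obtain ⟨s₁, s₂, h₁, h₂, hp⟩ := h.st m s hs
    exact hp.en_both hyc hzc
      (hen _ (le_of_step_le h.i_succ ((le_max_left _ _).trans hm)) _ h₁)
      (hen' _ (le_of_step_le h.j_succ ((le_max_right _ _).trans hm)) _ h₂)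

end UParDecomp

/-! ### Paths of restricted and relabelled processes -/

theorem Path.eq_some_of_rel {α β : Type*} {Q : α → β → Prop} {o : Option α} {o' : Option β}
    (h : Option.Rel Q o o') :
    (∀ s, o = some s → ∃ t, o' = some t ∧ Q s t) ∧ ∀ t, o' = some t → ∃ s, o = some s ∧ Q s t := by
  cases h <;> simp_all

/-- The path `π'` is the decomposition of the path `π` of a restricted process in `U`. -/
def UResDecomp (c : HS C) (π π' : UPath D) : Prop :=
  ∀ n, Option.Rel (URes D c) (π.st n) (π'.st n)

/-- The path `π'` is the decomposition of the path `π` of a relabelled process in `U`. -/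
def URelDecomp (f : Relabelling B C) (π π' : UPath D) : Prop :=
  ∀ n, Option.Rel (URel D f) (π.st n) (π'.st n)

theorem UResDecomp.hat {c : HS C} {π π' : UPath D} (h : UResDecomp c π π') :
    ResDecomp c π.hat π'.hat := by
  intro n
  have := h n
  rw [UPath.hat_st, UPath.hat_st]
  generalize π.st n = o at this
  generalize π'.st n = o' at this
  cases this with
  | none => exact .none
  | some h => exact .some h.hat

theorem URelDecomp.hat {f : Relabelling B C} {π π' : UPath D} (h : URelDecomp f π π') :
    RelDecomp f π.hat π'.hat := by
  intro n
  have := h n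
  rw [UPath.hat_st, UPath.hat_st]
  generalize π.st n = o at this
  generalize π'.st n = o' at this
  cases this with
  | none => exact .none
  | some h => exact .some h.hat

theorem UResDecomp.evEn {c : HS C} {π π' : UPath D} (h : UResDecomp c π π') {x : Shape A B C}
    (hx : π.EvEn x) : ∃ y, x = .res y c ∧ y.lab ≠ .hs c ∧ y.lab ≠ .hs c.bar ∧ π'.EvEn y := by
  obtain ⟨n, hn, hen⟩ := hx
  obtain ⟨s, hs⟩ := Option.isSome_iff_exists.1 hn
  obtain ⟨t, ht, hr⟩ := (Path.eq_some_of_rel (h n)).1 s hs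
  obtain ⟨y, rfl, h₁, h₂, -⟩ := hr.en (hen n le_rfl s hs)
  refine ⟨y, rfl, h₁, h₂, n, by simp [ht], fun m hm t ht => ?_⟩
  obtain ⟨s, hs, hr⟩ := (Path.eq_some_of_rel (h m)).2 t ht
  obtain ⟨y', e, -, -, hy⟩ := hr.en (hen m hm s hs)
  cases e
  exact hy

theorem UResDecomp.evEn_res {c : HS C} {π π' : UPath D} (h : UResDecomp c π π') {y : Shape A B C}
    (h₁ : y.lab ≠ .hs c) (h₂ : y.lab ≠ .hs c.bar) (hy : π'.EvEn y) : π.EvEn (.res y c) := by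
  obtain ⟨n, hn, hen⟩ := hy
  obtain ⟨t, ht⟩ := Option.isSome_iff_exists.1 hn
  obtain ⟨s, hs, -⟩ := (Path.eq_some_of_rel (h n)).2 t ht
  refine ⟨n, by simp [hs], fun m hm s hs => ?_⟩
  obtain ⟨t, ht, hr⟩ := (Path.eq_some_of_rel (h m)).1 s hs
  exact hr.en_res h₁ h₂ (hen m hm t ht)

theorem URelDecomp.evEn {f : Relabelling B C} {π π' : UPath D} (h : URelDecomp f π π')
    {x : Shape A B C} (hx : π.EvEn x) : ∃ y, x = .rel y f ∧ π'.EvEn y := by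
  obtain ⟨n, hn, hen⟩ := hx
  obtain ⟨s, hs⟩ := Option.isSome_iff_exists.1 hn
  obtain ⟨t, ht, hr⟩ := (Path.eq_some_of_rel (h n)).1 s hs
  obtain ⟨y, rfl, -⟩ := hr.en (hen n le_rfl s hs)
  refine ⟨y, rfl, n, by simp [ht], fun m hm t ht => ?_⟩
  obtain ⟨s, hs, hr⟩ := (Path.eq_some_of_rel (h m)).2 t ht
  obtain ⟨y', e, hy⟩ := hr.en (hen m hm s hs)
  cases e
  exact hy

theorem URelDecomp.evEn_rel {f : Relabelling B C} {π π' : UPath D} (h : URelDecomp f π π')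
    {y : Shape A B C} (hy : π'.EvEn y) : π.EvEn (.rel y f) := by
  obtain ⟨n, hn, hen⟩ := hy
  obtain ⟨t, ht⟩ := Option.isSome_iff_exists.1 hn
  obtain ⟨s, hs, -⟩ := (Path.eq_some_of_rel (h n)).2 t ht
  refine ⟨n, by simp [hs], fun m hm s hs => ?_⟩
  obtain ⟨t, ht, hr⟩ := (Path.eq_some_of_rel (h m)).1 s hs
  exact hr.en_rel (hen m hm t ht)

/-! ### Existence of decompositions in `U` -/

theorem UStep.proc_iff {P : Proc A B C} {s : UState D} :
    UStep D (.proc P) s ↔ ∃ χ h, s = .der χ h ∧ χ.src = P := by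
  constructor
  · rintro ⟨h⟩
    exact ⟨_, h, rfl, rfl⟩
  · rintro ⟨χ, h, rfl, rfl⟩
    exact .start h

theorem UStep.der_iff {χ : DTerm A B C} {h : IsDer D χ} {s : UState D} :
    UStep D (.der χ h) s ↔ s = .proc χ.tgt := by
  constructor
  · rintro ⟨_⟩
    rfl
  · rintro rfl
    exact .finish h

theorem exists_uResDecomp {c : HS C} {P : Proc A B C} {π : UPath D}
    (h₀ : π.st 0 = some (.proc (.res P c))) : ∃ π' : UPath D, UResDecomp c π π' := by
  refine Path.exists_rel (URes D c) π ?_ ?_ ?_ ?_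
  · intro s hs
    rw [h₀] at hs
    cases hs
    exact ⟨_, .proc P⟩
  · rintro s s' t h (P | ⟨h₁, h₂⟩)
    · obtain ⟨χ, hχ, rfl, hs⟩ := UStep.proc_iff.1 h
      cases χ <;> simp [DTerm.src] at hs
      obtain ⟨rfl, rfl⟩ := hs
      exact ⟨_, .der (isDer_res.1 hχ).1 hχ⟩
    · cases UStep.der_iff.1 h
      exact ⟨_, .proc _⟩
  · rintro s s' t t' h (P | ⟨h₁, h₂⟩) h'
    · obtain ⟨χ, hχ, rfl, hs⟩ := UStep.proc_iff.1 h
      cases h' with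
      | der h₁ _ =>
        cases hs
        exact .start h₁
    · cases UStep.der_iff.1 h
      cases h' with | proc _ => exact .finish h₁
  · rintro s t ⟨P, rfl⟩ h
    cases h with | proc P => exact ⟨P, rfl⟩

theorem exists_uRelDecomp {f : Relabelling B C} {P : Proc A B C} {π : UPath D}
    (h₀ : π.st 0 = some (.proc (.rel P f))) : ∃ π' : UPath D, URelDecomp f π π' := by
  refine Path.exists_rel (URel D f) π ?_ ?_ ?_ ?_
  · intro s hs
    rw [h₀] at hs
    cases hs
    exact ⟨_, .proc P⟩
  · rintro s s' t h (P | ⟨h₁, h₂⟩)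
    · obtain ⟨χ, hχ, rfl, hs⟩ := UStep.proc_iff.1 h
      cases χ <;> simp [DTerm.src] at hs
      obtain ⟨rfl, rfl⟩ := hs
      exact ⟨_, .der (isDer_rel.1 hχ) hχ⟩
    · cases UStep.der_iff.1 h
      exact ⟨_, .proc _⟩
  · rintro s s' t t' h (P | ⟨h₁, h₂⟩) h'
    · obtain ⟨χ, hχ, rfl, hs⟩ := UStep.proc_iff.1 h
      cases h' with
      | der h₁ _ =>
        cases hs
        exact .start h₁
    · cases UStep.der_iff.1 h
      cases h' with | proc _ => exact .finish h₁
  · rintro s t ⟨P, rfl⟩ h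
    cases h with | proc P => exact ⟨P, rfl⟩

theorem UPar.exists_of_step {s s' s₁ s₂ : UState D} (h : UPar D s s₁ s₂) (hs : UStep D s s') :
    ∃ t₁ t₂, UPar D s' t₁ t₂ := by
  cases h with
  | proc P Q =>
    obtain ⟨χ, hχ, rfl, e⟩ := UStep.proc_iff.1 hs
    cases χ <;> simp [DTerm.src] at e
    · exact ⟨_, _, .left (isDer_parL.1 hχ).1 hχ⟩
    · exact ⟨_, _, .right (isDer_parR.1 hχ).1 hχ⟩
    · exact ⟨_, _, .both (isDer_parB.1 hχ).1 (isDer_parB.1 hχ).2.1 hχ⟩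
  | left | right | both =>
    cases UStep.der_iff.1 hs
    exact ⟨_, _, .proc _ _⟩

/-- An idle component rests in a process, never in a derivation. This provides the end states
required by `Path.exists_destutter`. -/
theorem UPar.step {s t s₁ s₂ t₁ t₂ : UState D} (h : UPar D s s₁ s₂) (h' : UPar D t t₁ t₂)
    (hs : UStep D s t) :
    ((s₁ = t₁ ∧ s₁.IsProc) ∨ UStep D s₁ t₁) ∧ ((s₂ = t₂ ∧ s₂.IsProc) ∨ UStep D s₂ t₂) := by
  cases h with
  | proc P Q =>
    obtain ⟨χ, hχ, rfl, e⟩ := UStep.proc_iff.1 hs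
    cases h' with
    | left h₁ _ => cases e; exact ⟨.inr (.start h₁), .inl ⟨rfl, _, rfl⟩⟩
    | right h₂ _ => cases e; exact ⟨.inl ⟨rfl, _, rfl⟩, .inr (.start h₂)⟩
    | both h₁ h₂ _ => cases e; exact ⟨.inr (.start h₁), .inr (.start h₂)⟩
  | left h₁ _ =>
    cases UStep.der_iff.1 hs
    cases h' with | proc => exact ⟨.inr (.finish h₁), .inl ⟨rfl, _, rfl⟩⟩
  | right h₂ _ =>
    cases UStep.der_iff.1 hs
    cases h' with | proc => exact ⟨.inl ⟨rfl, _, rfl⟩, .inr (.finish h₂)⟩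
  | both h₁ h₂ _ =>
    cases UStep.der_iff.1 hs
    cases h' with | proc => exact ⟨.inr (.finish h₁), .inr (.finish h₂)⟩

/-- Parallel composition is never lost along the path, so the component states can be read off
everywhere; deleting the pauses of idle components gives the two paths. -/
theorem exists_uParDecomp {P Q : Proc A B C} {π : UPath D}
    (h₀ : π.st 0 = some (.proc (.par P Q))) : ∃ π₁ π₂ i j, UParDecomp π π₁ π₂ i j := by
  have ex : ∀ n s, π.st n = some s → ∃ s₁ s₂, UPar D s s₁ s₂ := by
    intro n
    induction n with
    | zero =>
      intro s hs
      rw [h₀] at hs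
      cases hs
      exact ⟨_, _, .proc P Q⟩
    | succ n ih =>
      intro s hs
      obtain ⟨s', hs'⟩ := Option.isSome_iff_exists.1
        (π.isSome_of_le n.le_succ (Option.isSome_iff_exists.2 ⟨s, hs⟩))
      obtain ⟨s₁, s₂, hp⟩ := ih s' hs'
      exact hp.exists_of_step (π.step n s' s hs' hs)
  have ex' : ∀ n, ∃ t : UState D × UState D, ∀ s, π.st n = some s → UPar D s t.1 t.2 := by
    intro n
    cases h : π.st n with
    -- A dummy pair beyond the end of the path.
    | none => exact ⟨(.proc P, .proc P), fun s hs => by cases hs⟩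
    | some s =>
      obtain ⟨s₁, s₂, hp⟩ := ex n s h
      exact ⟨(s₁, s₂), fun s' hs' => by cases hs'; exact hp⟩
  choose t ht using ex'
  have step : ∀ m, (π.st (m + 1)).isSome →
      (((t m).1 = (t (m + 1)).1 ∧ (t m).1.IsProc) ∨ UStep D (t m).1 (t (m + 1)).1) ∧
      (((t m).2 = (t (m + 1)).2 ∧ (t m).2.IsProc) ∨ UStep D (t m).2 (t (m + 1)).2) := by
    intro m hm
    obtain ⟨s', hs'⟩ := Option.isSome_iff_exists.1 hm
    obtain ⟨s, hs⟩ := Option.isSome_iff_exists.1 (π.isSome_of_le m.le_succ hm)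
    exact (ht m s hs).step (ht (m + 1) s' hs') (π.step m s s' hs hs')
  have last : ∀ m, (π.st m).isSome → ¬ (π.st (m + 1)).isSome →
      (t m).1.IsProc ∧ (t m).2.IsProc := by
    intro m hm hm'
    obtain ⟨s, hs⟩ := Option.isSome_iff_exists.1 hm
    obtain ⟨P, rfl⟩ := π.last m s hs (by simpa using hm')
    have := ht m _ hs
    generalize (t m).1 = a at this
    generalize (t m).2 = b at this
    cases this
    exact ⟨⟨_, rfl⟩, ⟨_, rfl⟩⟩
  have hd : ∀ m, (π.st (m + 1)).isSome → (π.st m).isSome :=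
    fun m hm => π.isSome_of_le m.le_succ hm
  obtain ⟨π₁, i, i₀, hi, h₁, hs₁⟩ := Path.exists_destutter (R' := UStep D) (E' := UState.IsProc)
    (fun m => (π.st m).isSome) (fun m => (t m).1)
    π.nonempty hd (fun m hm => (step m hm).1) fun m hm hm' => (last m hm hm').1
  obtain ⟨π₂, j, j₀, hj, h₂, hs₂⟩ := Path.exists_destutter (R' := UStep D) (E' := UState.IsProc)
    (fun m => (π.st m).isSome) (fun m => (t m).2)
    π.nonempty hd (fun m hm => (step m hm).2) fun m hm hm' => (last m hm hm').2
  refine ⟨π₁, π₂, i, j, i₀, j₀, hi, hj, fun m s hs => ?_, hs₁, hs₂⟩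
  exact ⟨_, _, h₁ m (by simp [hs]), h₂ m (by simp [hs]), ht m s hs⟩

end Decomposition

section Justness

variable {A : Type u} {B : Type v} {C : Type w} {D : A → Proc A B C}

/-! ### From paths in `U` to justness -/

/-- The labels that must not be enabled forever on a `Y`-just path. -/
def Act.Forced (Y : Set (HS C)) (α : Act B C) : Prop :=
  ¬ ((∃ c ∈ Y, α = .hs c) ∨ α.IsReceive)

theorem Act.Forced.mono {Y Z : Set (HS C)} (h : Z ⊆ Y) {α : Act B C} (hα : α.Forced Y) :
    α.Forced Z :=
  fun hZ => hα (hZ.imp_left fun ⟨c, hc, e⟩ => ⟨c, h hc, e⟩)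

theorem Act.forced_tau (Y : Set (HS C)) : (.tau : Act B C).Forced Y := by
  rintro (⟨c, -, h⟩ | ⟨b, h⟩) <;> cases h

theorem Act.forced_onAct {Y : Set (HS C)} {f : Relabelling B C} {α : Act B C} :
    (f.onAct α).Forced Y ↔ α.Forced (f.onHS ⁻¹' Y) := by
  cases α <;> simp [Forced, Relabelling.onAct, IsReceive]

theorem Act.forced_res {Y : Set (HS C)} {c : HS C} {α : Act B C} :
    α.Forced (Y ∪ {c, c.bar}) ↔ α.Forced Y ∧ α ≠ .hs c ∧ α ≠ .hs c.bar := by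
  cases α <;> simp [Forced, IsReceive]
  tauto

/-- This is why fairness for non-blocking actions yields `Y`-justness with `Y` the set of all
handshake actions. -/
theorem Act.forced_univ {α : Act B C} : α.Forced Set.univ ↔ α.NonBlocking := by
  cases α with
  | bc s b => cases s <;> simp [Forced, IsReceive, NonBlocking, IsBroadcast]
  | hs c => simp [Forced, NonBlocking, IsBroadcast]
  | tau => simp [Forced, NonBlocking, IsReceive]

theorem Act.NonBlocking.forced {α : Act B C} (h : α.NonBlocking) (Y : Set (HS C)) :
    α.Forced Y :=
  (Act.forced_univ.2 h).mono (Set.subset_univ Y)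

/-- No shape whose label is neither in `Y` nor a receive action is enabled forever on `π`. -/
def UPath.Fair (Y : Set (HS C)) (π : UPath D) : Prop :=
  ∀ x : Shape A B C, x.lab.Forced Y → ¬ π.EvEn x

/-- `X` and `Z` collect the handshake labels of shapes enabled forever in the components. They are
the smallest sets with a chance of making the components fair; other forced labels are excluded by
the fairness of `π`. Disjointness holds because `τ` is forced for every `Y`. -/
theorem UPath.Fair.exists_par (hD : ∀ a, (D a).Guarded) {Y : Set (HS C)} {π π₁ π₂ : UPath D}
    {i j : ℕ → ℕ} (hY : π.Fair Y) (h : UParDecomp π π₁ π₂ i j) :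
    ∃ X Z, π₁.Fair X ∧ π₂.Fair Z ∧ X ∪ Z ⊆ Y ∧ X ∩ HS.bar '' Z = ∅ := by
  have lab : ∀ {π : UPath D} {x : Shape A B C}, π.EvEn x → ¬ x.lab.IsReceive := by
    rintro π x ⟨n, hn, hen⟩
    obtain ⟨s, hs⟩ := Option.isSome_iff_exists.1 hn
    exact (hen n le_rfl s hs).not_isReceive
  -- Serves both components, with `g` the embedding `left` or `right`.
  have fair : ∀ {π' : UPath D} (g : Shape A B C → Shape A B C), (∀ x, (g x).lab = x.lab) →
      (∀ x, π'.EvEn x → π.EvEn (g x)) →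
      π'.Fair {c | ∃ x, x.lab = .hs c ∧ π'.EvEn x} ∧
        {c | ∃ x, x.lab = .hs c ∧ π'.EvEn x} ⊆ Y := by
    intro π' g hg hπ
    constructor
    · intro x hx hen
      refine hY (g x) ?_ (hπ x hen)
      rw [hg]
      rintro (⟨c, hc, e⟩ | hr)
      · exact hx (.inl ⟨c, ⟨x, e, hen⟩, e⟩)
      · exact hx (.inr hr)
    · rintro c ⟨x, e, hen⟩
      by_contra hc
      refine hY (g x) ?_ (hπ x hen)
      rw [hg]
      rintro (⟨c', hc', e'⟩ | hr)
      · rw [e] at e'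
        cases e'
        exact hc hc'
      · exact lab hen hr
  obtain ⟨h₁, h₁'⟩ := fair .left (fun _ => rfl) fun x => h.evEn_left hD
  obtain ⟨h₂, h₂'⟩ := fair .right (fun _ => rfl) fun x => h.evEn_right hD
  refine ⟨_, _, h₁, h₂, Set.union_subset h₁' h₂', Set.eq_empty_iff_forall_notMem.2 ?_⟩
  rintro _ ⟨⟨x, ex, hx⟩, c, ⟨z, ez, hz⟩, rfl⟩
  exact hY (.both x z) (Act.forced_tau Y) (h.evEn_both ex (by rw [HS.bar_bar, ez]) hx hz)

theorem isJustFamily_fair (hD : ∀ a, (D a).Guarded) :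
    IsJustFamily fun Y (ρ : SPath D) => ∃ π : UPath D, ρ = π.hat ∧ π.Fair Y where
  finite := by
    rintro Y _ ⟨π, rfl, hY⟩ n _ hs hn
    simp only [UPath.hat_st, Option.map_eq_some_iff, Option.map_eq_none_iff] at hs hn
    obtain ⟨s, hs, rfl⟩ := hs
    obtain ⟨Q, rfl⟩ := π.last n s hs hn
    refine ⟨Q, rfl, fun α R ⟨χ, hχ⟩ => ?_⟩
    obtain ⟨rfl, rfl, rfl⟩ := hχ.eq
    by_contra hα
    have hd : Dom D χ := ⟨⟨_, _, _, hχ⟩, fun h => hα (.inr h)⟩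
    -- On a finite path, enabled in the last state already means enabled forever.
    refine hY χ.shape (by rwa [hd.lab_shape]) ⟨n, by simp [hs], fun m hm s' hs' => ?_⟩
    obtain rfl | hm := hm.eq_or_lt
    · rw [hs] at hs'
      cases hs'
      exact ⟨χ, hd, rfl, rfl⟩
    · have := π.isSome_of_le hm (Option.isSome_iff_exists.2 ⟨s', hs'⟩)
      simp [hn] at this
  par := by
    rintro Y _ ⟨π, rfl, hY⟩ P Q h₀
    simp only [UPath.hat_st, Option.map_eq_some_iff] at h₀
    obtain ⟨s, h₀, e⟩ := h₀
    cases UState.eq_proc_of_hat e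
    obtain ⟨π₁, π₂, i, j, h⟩ := exists_uParDecomp h₀
    obtain ⟨X, Z, h₁, h₂, h₃, h₄⟩ := hY.exists_par hD h
    exact ⟨X, Z, _, _, h.hat, ⟨π₁, rfl, h₁⟩, ⟨π₂, rfl, h₂⟩, h₃, h₄⟩
  res := by
    rintro Y _ ⟨π, rfl, hY⟩ P c h₀
    simp only [UPath.hat_st, Option.map_eq_some_iff] at h₀
    obtain ⟨s, h₀, e⟩ := h₀
    cases UState.eq_proc_of_hat e
    obtain ⟨π', h⟩ := exists_uResDecomp h₀
    refine ⟨_, h.hat, π', rfl, fun x hx hen => ?_⟩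
    obtain ⟨hx, h₁, h₂⟩ := Act.forced_res.1 hx
    exact hY (.res x c) hx (h.evEn_res h₁ h₂ hen)
  rel := by
    rintro Y _ ⟨π, rfl, hY⟩ P f h₀
    simp only [UPath.hat_st, Option.map_eq_some_iff] at h₀
    obtain ⟨s, h₀, e⟩ := h₀
    cases UState.eq_proc_of_hat e
    obtain ⟨π', h⟩ := exists_uRelDecomp h₀
    exact ⟨_, h.hat, π', rfl, fun x hx hen =>
      hY (.rel x f) (Act.forced_onAct.2 hx) (h.evEn_rel hen)⟩
  suffix := by
    rintro Y _ ⟨π, rfl, hY⟩ n hn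
    have hn' : (π.st n).isSome := by simpa [UPath.hat_st] using hn
    refine ⟨π.suffix n hn', Path.ext rfl, fun x hx ⟨m, hm, hen⟩ => ?_⟩
    refine hY x hx ⟨n + m, hm, fun k hk s hs => ?_⟩
    obtain ⟨k, rfl⟩ := Nat.exists_eq_add_of_le hk
    exact hen (m + k) (Nat.le_add_right _ _) s (by rw [← hs, Nat.add_assoc]; rfl)

/-! ### From justness to paths in `U` -/

/-- A `Y`-just path that starts in a process. -/
structure JustPath (D : A → Proc A B C) : Type (max u v w) where
  Y : Set (HS C)
  path : SPath D
  just : YJust Y path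
  start : Proc A B C
  st_zero : path.st 0 = some (.proc start)

/-- The just path `j` of a parallel composition is decomposed into the just paths `l` and `r`. -/
structure JustPath.IsPar (j l r : JustPath D) (i k : ℕ → ℕ) : Prop where
  start_eq : j.start = .par l.start r.start
  subset : l.Y ∪ r.Y ⊆ j.Y
  disjoint : l.Y ∩ HS.bar '' r.Y = ∅
  i_zero : i 0 = 0
  k_zero : k 0 = 0
  i_succ : ∀ m, i (m + 1) = i m ∨ i (m + 1) = i m + 1
  k_succ : ∀ m, k (m + 1) = k m ∨ k (m + 1) = k m + 1
  st : ∀ m s, j.path.st m = some s →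
    ∃ s₁ s₂, l.path.st (i m) = some s₁ ∧ r.path.st (k m) = some s₂ ∧ ParState D s s₁ s₂
  i_surj : ∀ n, (l.path.st n).isSome → ∃ m, (j.path.st m).isSome ∧ i m = n
  k_surj : ∀ n, (r.path.st n).isSome → ∃ m, (j.path.st m).isSome ∧ k m = n

/-- The just path `j` of a restricted process is decomposed into the just path `j'`. -/
structure JustPath.IsRes (j j' : JustPath D) (c : HS C) : Prop where
  start_eq : j.start = .res j'.start c
  Y_eq : j'.Y = j.Y ∪ {c, c.bar}
  decomp : ResDecomp c j.path j'.path

/-- The just path `j` of a relabelled process is decomposed into the just path `j'`. -/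
structure JustPath.IsRel (j j' : JustPath D) (f : Relabelling B C) : Prop where
  start_eq : j.start = .rel j'.start f
  Y_eq : j'.Y = f.onHS ⁻¹' j.Y
  decomp : RelDecomp f j.path j'.path

/-- The just path `j` of a process that is not static continues as `j'` after one transition. -/
structure JustPath.IsNext (j j' : JustPath D) : Prop where
  not_static : ¬ j.start.IsStatic
  Y_eq : j'.Y = j.Y
  st : ∀ n, j'.path.st n = j.path.st (n + 2)

/-- A way to analyse the just path `j`. -/
inductive JustPath.View (j : JustPath D) : Type (max u v w)
  | par (l r : JustPath D) (i k : ℕ → ℕ) (h : j.IsPar l r i k)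
  | res (j' : JustPath D) (c : HS C) (h : j.IsRes j' c)
  | rel (j' : JustPath D) (f : Relabelling B C) (h : j.IsRel j' f)
  | next (j' : JustPath D) (h : j.IsNext j')
  | halt (h : ¬ j.start.IsStatic) (h₂ : j.path.st 2 = none)

theorem JustPath.nonempty_view (j : JustPath D) : Nonempty j.View := by
  by_cases hs : j.start.IsStatic
  · have h₀ := j.st_zero
    have hst : ∀ P, j.start = P → j.path.st 0 = some (.proc P) := by
      rintro _ rfl
      exact h₀
    cases e : j.start with
    | nil | pre | sum | ident => simp [e, Proc.IsStatic] at hs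
    | par P Q =>
      obtain ⟨X, Z, π₁, π₂, ⟨i, k, hi, hk, hi', hk', h, hi'', hk''⟩, h₁, h₂, h₃, h₄⟩ :=
        isJustFamily_YJust.par _ _ j.just P Q (hst _ e)
      obtain ⟨s₁, s₂, e₁, e₂, hp⟩ := h 0 _ (hst _ e)
      rw [hi] at e₁
      rw [hk] at e₂
      cases hp
      exact ⟨.par ⟨X, π₁, h₁, P, e₁⟩ ⟨Z, π₂, h₂, Q, e₂⟩ i k
        ⟨e, h₃, h₄, hi, hk, hi', hk', h, hi'', hk''⟩⟩
    | res P c =>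
      obtain ⟨π, h, h₁⟩ := isJustFamily_YJust.res _ _ j.just P c (hst _ e)
      obtain ⟨s, e', hp⟩ := (Path.eq_some_of_rel (h 0)).1 _ (hst _ e)
      cases hp
      exact ⟨.res ⟨_, π, h₁, P, e'⟩ c ⟨e, rfl, h⟩⟩
    | rel P f =>
      obtain ⟨π, h, h₁⟩ := isJustFamily_YJust.rel _ _ j.just P f (hst _ e)
      obtain ⟨s, e', hp⟩ := (Path.eq_some_of_rel (h 0)).1 _ (hst _ e)
      cases hp
      exact ⟨.rel ⟨_, π, h₁, P, e'⟩ f ⟨e, rfl, h⟩⟩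
  · cases h₂ : j.path.st 2 with
    | none => exact ⟨.halt hs h₂⟩
    | some s =>
      have hsome : (j.path.st 2).isSome := by simp [h₂]
      obtain ⟨t, h₁⟩ := Option.isSome_iff_exists.1 (j.path.isSome_of_le one_le_two hsome)
      cases j.path.step 0 _ _ j.st_zero h₁ with
      | start h =>
        cases j.path.step 1 _ _ h₁ h₂ with
        | finish h =>
          -- The transition is itself a state of the path, so one transition shifts positions by
          -- two.
          exact ⟨.next ⟨j.Y, j.path.suffix 2 hsome, isJustFamily_YJust.suffix _ _ j.just 2 hsome,
            _, h₂⟩ ⟨hs, rfl, fun n => congrArg j.path.st (Nat.add_comm 2 n)⟩⟩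

/-! ### Choosing derivations along a just path -/

/-- A choice of a decomposition of each just path. -/
noncomputable def JustPath.view (j : JustPath D) : j.View := j.nonempty_view.some

theorem JustPath.IsPar.exists_lift {j l r : JustPath D} {i k : ℕ → ℕ} (h : j.IsPar l r i k)
    (n : ℕ) (g₁ : {g : Option (UState D) // g.map UState.hat = l.path.st (i n)})
    (g₂ : {g : Option (UState D) // g.map UState.hat = r.path.st (k n)}) :
    ∃ g : Option (UState D), g.map UState.hat = j.path.st n ∧
      ∀ s, g = some s → ∃ s₁ s₂, g₁.1 = some s₁ ∧ g₂.1 = some s₂ ∧ UPar D s s₁ s₂ := by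
  cases hn : j.path.st n with
  | none => exact ⟨none, rfl, fun s hs => by cases hs⟩
  | some s =>
    obtain ⟨s₁, s₂, h₁, h₂, hp⟩ := h.st n s hn
    obtain ⟨u₁, e₁, rfl⟩ := Option.map_eq_some_iff.1 (g₁.2.trans h₁)
    obtain ⟨u₂, e₂, rfl⟩ := Option.map_eq_some_iff.1 (g₂.2.trans h₂)
    obtain ⟨t, rfl, ht⟩ := hp.exists_lift
    exact ⟨some t, rfl, fun s hs => by cases hs; exact ⟨_, _, e₁, e₂, ht⟩⟩

theorem JustPath.IsRes.exists_lift {j j' : JustPath D} {c : HS C} (h : j.IsRes j' c)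
    (n : ℕ) (g' : {g : Option (UState D) // g.map UState.hat = j'.path.st n}) :
    ∃ g : Option (UState D), g.map UState.hat = j.path.st n ∧ Option.Rel (URes D c) g g'.1 := by
  have h' := h.decomp n
  rw [← g'.2] at h'
  generalize g'.1 = o at h'
  generalize j.path.st n = o' at h'
  cases o with
  | none => cases h'; exact ⟨none, rfl, .none⟩
  | some s =>
    cases h' with
    | some h' =>
      obtain ⟨t, rfl, ht⟩ := h'.exists_lift
      exact ⟨some t, rfl, .some ht⟩

theorem JustPath.IsRel.exists_lift {j j' : JustPath D} {f : Relabelling B C} (h : j.IsRel j' f)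
    (n : ℕ) (g' : {g : Option (UState D) // g.map UState.hat = j'.path.st n}) :
    ∃ g : Option (UState D), g.map UState.hat = j.path.st n ∧ Option.Rel (URel D f) g g'.1 := by
  have h' := h.decomp n
  rw [← g'.2] at h'
  generalize g'.1 = o at h'
  generalize j.path.st n = o' at h'
  cases o with
  | none => cases h'; exact ⟨none, rfl, .none⟩
  | some s =>
    cases h' with
    | some h' =>
      obtain ⟨t, rfl, ht⟩ := h'.exists_lift
      exact ⟨some t, rfl, .some ht⟩

theorem JustPath.exists_lift (j : JustPath D) (n : ℕ) :
    ∃ g : Option (UState D), g.map UState.hat = j.path.st n := by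
  cases j.path.st n with
  | none => exact ⟨none, rfl⟩
  | some s =>
    obtain ⟨t, rfl⟩ := UState.hat_surjective s
    exact ⟨some t, rfl⟩

theorem JustPath.IsPar.i_le {j l r : JustPath D} {i k : ℕ → ℕ} (h : j.IsPar l r i k) (n : ℕ) :
    i n ≤ n := by
  induction n with
  | zero => exact h.i_zero.le
  | succ n ih => have := h.i_succ n; omega

theorem JustPath.IsPar.k_le {j l r : JustPath D} {i k : ℕ → ℕ} (h : j.IsPar l r i k) (n : ℕ) :
    k n ≤ n := by
  induction n with
  | zero => exact h.k_zero.le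
  | succ n ih => have := h.k_succ n; omega

/-- The derivations chosen for the transitions of a just path, in accordance with the chosen
decompositions. -/
noncomputable def JustPath.lift (j : JustPath D) (n : ℕ) :
    {g : Option (UState D) // g.map UState.hat = j.path.st n} :=
  match j.view with
  | .par l r i k h =>
    have e := h.exists_lift n (l.lift (i n)) (r.lift (k n))
    ⟨e.choose, e.choose_spec.1⟩
  | .res j' _ h =>
    have e := h.exists_lift n (j'.lift n)
    ⟨e.choose, e.choose_spec.1⟩
  | .rel j' _ h =>
    have e := h.exists_lift n (j'.lift n)
    ⟨e.choose, e.choose_spec.1⟩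
  | .next j' h =>
    if hn : 2 ≤ n then
      ⟨(j'.lift (n - 2)).1, (j'.lift (n - 2)).2.trans (by rw [h.st, Nat.sub_add_cancel hn])⟩
    -- Up to and including the first transition of a non-static process, any derivation will do.
    else ⟨(j.exists_lift n).choose, (j.exists_lift n).choose_spec⟩
  | .halt _ _ => ⟨(j.exists_lift n).choose, (j.exists_lift n).choose_spec⟩
-- Component indices never exceed `n`, and at equal position the start process is a proper subterm.
-- Passing to `next` may enlarge the process but lowers the position by two.
termination_by (n, sizeOf j.start)
decreasing_by
  · have := h.i_le n
    rcases this.eq_or_lt with e | e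
    · rw [e]; apply Prod.Lex.right; rw [h.start_eq]; simp; omega
    · exact Prod.Lex.left _ _ e
  · have := h.k_le n
    rcases this.eq_or_lt with e | e
    · rw [e]; apply Prod.Lex.right; rw [h.start_eq]; simp
    · exact Prod.Lex.left _ _ e
  · apply Prod.Lex.right; rw [h.start_eq]; simp; omega
  · apply Prod.Lex.right; rw [h.start_eq]; simp; omega
  · apply Prod.Lex.left; omega

/-- The path in `U` chosen for a just path. -/
noncomputable def JustPath.upath (j : JustPath D) : UPath D :=
  .ofLift j.path (fun n => (j.lift n).1) fun n => (j.lift n).2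

theorem JustPath.hat_upath (j : JustPath D) : j.upath.hat = j.path := UPath.hat_ofLift _ _ _

theorem JustPath.isSome_upath (j : JustPath D) (n : ℕ) :
    (j.upath.st n).isSome = (j.path.st n).isSome := by
  rw [← j.hat_upath, UPath.hat_st, Option.isSome_map]

theorem JustPath.IsPar.decomp {j l r : JustPath D} {i k : ℕ → ℕ} {h : j.IsPar l r i k}
    (hv : j.view = .par l r i k h) : UParDecomp j.upath l.upath r.upath i k where
  i_zero := h.i_zero
  j_zero := h.k_zero
  i_succ := h.i_succ
  j_succ := h.k_succ
  st m s hs := by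
    have e := h.exists_lift m (l.lift (i m)) (r.lift (k m))
    have hm : (j.lift m).1 = e.choose := by
      rw [JustPath.lift, hv]
    exact e.choose_spec.2 s (hm.symm.trans hs)
  i_surj n := by
    simpa only [JustPath.isSome_upath] using h.i_surj n
  j_surj n := by
    simpa only [JustPath.isSome_upath] using h.k_surj n

theorem JustPath.IsRes.uResDecomp {j j' : JustPath D} {c : HS C} {h : j.IsRes j' c}
    (hv : j.view = .res j' c h) : UResDecomp c j.upath j'.upath := by
  intro n
  have e := h.exists_lift n (j'.lift n)
  have hn : (j.lift n).1 = e.choose := by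
    rw [JustPath.lift, hv]
  change Option.Rel (URes D c) (j.lift n).1 (j'.lift n).1
  rw [hn]
  exact e.choose_spec.2

theorem JustPath.IsRel.uRelDecomp {j j' : JustPath D} {f : Relabelling B C} {h : j.IsRel j' f}
    (hv : j.view = .rel j' f h) : URelDecomp f j.upath j'.upath := by
  intro n
  have e := h.exists_lift n (j'.lift n)
  have hn : (j.lift n).1 = e.choose := by
    rw [JustPath.lift, hv]
  change Option.Rel (URel D f) (j.lift n).1 (j'.lift n).1
  rw [hn]
  exact e.choose_spec.2

theorem JustPath.IsNext.upath_st {j j' : JustPath D} {h : j.IsNext j'}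
    (hv : j.view = .next j' h) (n : ℕ) : j.upath.st (n + 2) = j'.upath.st n := by
  change (j.lift (n + 2)).1 = (j'.lift n).1
  rw [JustPath.lift, hv]
  simp only [Nat.le_add_left, dif_pos]
  rw [Nat.add_sub_cancel]

/-! ### Fairness of the chosen path -/

/-- A forced label is not enabled in the last state of a just path. -/
theorem JustPath.not_en_last (j : JustPath D) {x : Shape A B C} (hx : x.lab.Forced j.Y) {n : ℕ}
    {s : UState D} (hs : j.upath.st n = some s) (hn : j.upath.st (n + 1) = none) : ¬ s.En x := by
  intro hen
  obtain ⟨Q, e, h⟩ := isJustFamily_YJust.finite _ _ j.just n s.hat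
    (by rw [← j.hat_upath, UPath.hat_st, hs]; rfl)
    (by rw [← j.hat_upath, UPath.hat_st, hn]; rfl)
  cases UState.eq_proc_of_hat e
  obtain ⟨χ, hχ, rfl, rfl⟩ := hen
  rw [hχ.lab_shape] at hx
  exact hx (h _ _ ⟨χ, hχ.1.derives⟩)

theorem UPath.EvEn.of_shift {π π' : UPath D} {k : ℕ} (h : ∀ n, π.st (n + k) = π'.st n)
    {x : Shape A B C} {n : ℕ} (hn : (π.st (n + k)).isSome)
    (hen : ∀ m, n + k ≤ m → ∀ s, π.st m = some s → s.En x) : π'.EvEn x :=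
  ⟨n, by rwa [← h], fun m hm s hs =>
    hen (m + k) (Nat.add_le_add_right hm k) s ((h m).trans hs)⟩

/-- A shape enabled forever is enabled forever on a continuation that starts in a static process,
from where its decomposition can be followed. -/
theorem JustPath.exists_static (j : JustPath D) {x : Shape A B C} (hx : x.lab.Forced j.Y)
    (hen : j.upath.EvEn x) :
    ∃ j' : JustPath D, j'.Y = j.Y ∧ j'.start.IsStatic ∧ j'.upath.EvEn x := by
  obtain ⟨n, hn, hen⟩ := hen
  induction n using Nat.strong_induction_on generalizing j with
  | _ n ih =>
    by_cases hs : j.start.IsStatic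
    · exact ⟨j, rfl, hs, n, hn, hen⟩
    -- If `x` is permanently enabled from position 0 or 1 on, the first transition takes place while
    -- `x` is enabled: the path cannot stop before it, as `x` is forced. Its derivation has
    -- something concurrent to it, hence a static target.
    have short : n < 2 → ∃ χ h₁, j.upath.st 1 = some (.der χ h₁) ∧
        j.upath.st 2 = some (.proc χ.tgt) ∧ χ.tgt.IsStatic := by
      intro hn2
      have h₀ : j.upath.st 0 = some (.proc j.start) := by
        obtain ⟨s, hs₀⟩ := Option.isSome_iff_exists.1 j.upath.nonempty
        have : some s.hat = some (SState.proc j.start) := by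
          rw [← j.st_zero, ← j.hat_upath, UPath.hat_st, hs₀]
          rfl
        rw [hs₀, UState.eq_proc_of_hat (Option.some.inj this)]
      cases h₁ : j.upath.st 1 with
      | none =>
        have : n = 0 := by
          by_contra h
          have : n = 1 := by omega
          rw [this, h₁] at hn
          cases hn
        subst this
        exact absurd (hen 0 le_rfl _ h₀) (j.not_en_last hx h₀ h₁)
      | some s =>
        obtain ⟨χ, hχ, rfl, -⟩ := UStep.proc_iff.1 (j.upath.step 0 _ _ h₀ h₁)
        obtain ⟨χ', -, -, hc⟩ := hen 1 (by omega) _ h₁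
        cases h₂ : j.upath.st 2 with
        | none =>
          obtain ⟨_, e⟩ := j.upath.last 1 _ h₁ h₂
          cases e
        | some t =>
          cases UStep.der_iff.1 (j.upath.step 1 _ _ h₁ h₂)
          exact ⟨χ, hχ, rfl, rfl, hc.isStatic_tgt⟩
    cases hv : j.view with
    | par _ _ _ _ h => exact absurd (by simp [h.start_eq, Proc.IsStatic]) hs
    | res _ _ h => exact absurd (by simp [h.start_eq, Proc.IsStatic]) hs
    | rel _ _ h => exact absurd (by simp [h.start_eq, Proc.IsStatic]) hs
    | halt _ h₂ =>
      have h₂' : j.upath.st 2 = none := by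
        have := j.isSome_upath 2
        simpa [h₂] using this
      by_cases hn2 : n < 2
      · obtain ⟨χ, _, _, h, _⟩ := short hn2
        rw [h] at h₂'
        cases h₂'
      · have := j.upath.isSome_of_le (not_lt.1 hn2) hn
        rw [h₂'] at this
        cases this
    | next j' h =>
      have hst := JustPath.IsNext.upath_st hv
      by_cases hn2 : n < 2
      · obtain ⟨χ, _, _, h₂, hχ⟩ := short hn2
        refine ⟨j', h.Y_eq, ?_, .of_shift (n := 0) hst (by simp [h₂])
          fun m hm => hen m (by omega)⟩
        have : some (SState.proc χ.tgt : SState D) = some (.proc j'.start) := by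
          rw [← j'.st_zero, ← j'.hat_upath, UPath.hat_st, ← hst, h₂]
          rfl
        rw [← SState.proc.inj (Option.some.inj this)]
        exact hχ
      -- The enabled tail begins after the first transition; continuing from there lowers its
      -- starting position by two.
      · obtain ⟨k, rfl⟩ := Nat.exists_eq_add_of_le' (not_lt.1 hn2)
        obtain ⟨j'', hY, h₁, h₂⟩ := ih k (by omega) j' (by rwa [h.Y_eq]) (by rwa [← hst])
          fun m hm s hs => hen (m + 2) (by omega) s ((hst m).trans hs)
        exact ⟨j'', hY.trans h.Y_eq, h₁, h₂⟩

/-- The path in `U` chosen for a `Y`-just path satisfies the fairness requirement for `Y`. -/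
theorem JustPath.fair (j : JustPath D) : j.upath.Fair j.Y := by
  intro x
  -- The induction is on the shape, not on the process, which may grow along the path.
  induction hn : sizeOf x using Nat.strong_induction_on generalizing x j with
  | _ n ih =>
    subst hn
    intro hx hen
    -- A prefix is disabled by every derivation, so it could be enabled forever only in a last
    -- state, which a forced label rules out.
    by_cases hact : ∃ α P, x = .act α P
    · obtain ⟨α, P, rfl⟩ := hact
      obtain ⟨n, hn, hen⟩ := hen
      obtain ⟨s, hs⟩ := Option.isSome_iff_exists.1 hn
      cases hs' : j.upath.st (n + 1) with
      | none => exact j.not_en_last hx hs hs' (hen n le_rfl s hs)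
      | some s' =>
        cases s with
        | der χ hχ => exact UState.not_en_act (hen n le_rfl _ hs)
        | proc P =>
          obtain ⟨χ, hχ, rfl, -⟩ := UStep.proc_iff.1 (j.upath.step n _ _ hs hs')
          exact UState.not_en_act (hen (n + 1) n.le_succ _ hs')
    · obtain ⟨j, hY, hs, hen⟩ := j.exists_static hx hen
      rw [← hY] at hx
      cases hv : j.view with
      | halt h => exact h hs
      | next _ h => exact h.not_static hs
      | par l r i k h =>
        obtain ⟨hl, hr⟩ := Set.union_subset_iff.1 h.subset
        obtain ⟨y, rfl, hy⟩ | ⟨z, rfl, hz⟩ | ⟨y, z, c, rfl, hyc, hzc, hy, hz⟩ :=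
          (JustPath.IsPar.decomp hv).evEn hen
        · exact ih _ (by simp) l y rfl (hx.mono hl) hy
        · exact ih _ (by simp) r z rfl (hx.mono hr) hz
        -- The label `c` cannot be tolerated on the left while its complement is tolerated on the
        -- right, so the handshake has at least one partner whose label is forced in its component.
        · by_cases hc : c ∈ l.Y
          · refine ih _ (by simp) r z rfl ?_ hz
            rw [hzc]
            rintro (⟨c', hc', e⟩ | ⟨b, e⟩)
            · cases e
              exact Set.eq_empty_iff_forall_notMem.1 h.disjoint c ⟨hc, _, hc', HS.bar_bar c⟩
            · cases e
          · refine ih _ (by simp; omega) l y rfl ?_ hy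
            rw [hyc]
            rintro (⟨c', hc', e⟩ | ⟨b, e⟩)
            · cases e
              exact hc hc'
            · cases e
      | res j' c h =>
        obtain ⟨y, rfl, h₁, h₂, hy⟩ := (JustPath.IsRes.uResDecomp hv).evEn hen
        exact ih _ (by simp; omega) j' y rfl
          (by rw [h.Y_eq]; exact Act.forced_res.2 ⟨hx, h₁, h₂⟩) hy
      | rel j' f h =>
        obtain ⟨y, rfl, hy⟩ := (JustPath.IsRel.uRelDecomp hv).evEn hen
        exact ih _ (by simp; omega) j' y rfl (by rw [h.Y_eq]; exact Act.forced_onAct.1 hx) hy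

end Justness

end ABC

/-! ### The characterisation of just paths -/

theorem mainTheorem1 {A : Type*} {B : Type*} {C : Type*}
    (D : A → ABC.Proc A B C) (hD : ∀ a, (D a).Guarded)
    (P : ABC.Proc A B C) (ρ : ABC.SPath D) (hρ : ρ.st 0 = some (.proc P)) :
    ABC.Just ρ ↔
      ∃ π : ABC.UPath D, ρ = ABC.UPath.hat π ∧
        ∀ ν : ABC.AbsTrans D, ν.lab.NonBlocking →
          ABC.Path.Sat ABC.UState.Holds (ABC.justice ν) π := by
  constructor
  · rintro ⟨Y, h⟩
    let j : ABC.JustPath D := ⟨Y, ρ, h, P, hρ⟩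
    refine ⟨j.upath, j.hat_upath.symm, fun ν => ?_⟩
    induction ν using Quotient.inductionOn with
    | h χ =>
      intro hν
      refine (ABC.sat_justice_iff _ χ).2 (j.fair _ ?_)
      rw [χ.2.lab_shape]
      exact hν.forced Y
  · rintro ⟨π, rfl, h⟩
    refine ⟨Set.univ, _, ABC.isJustFamily_fair hD, π, rfl, fun x hx hen => ?_⟩
    obtain ⟨n, hn, hn'⟩ := id hen
    obtain ⟨s, hs⟩ := Option.isSome_iff_exists.1 hn
    -- Not every tree is the shape of a derivation, but one that is enabled somewhere is, and so it
    -- names an abstract transition to which the hypothesis applies.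
    obtain ⟨χ, hχ, rfl⟩ := (hn' n le_rfl s hs).dom
    rw [hχ.lab_shape] at hx
    exact (ABC.sat_justice_iff π ⟨χ, hχ⟩).1 (h (Quotient.mk _ ⟨χ, hχ⟩)
      (ABC.Act.forced_univ.1 hx)) hen
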